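/- Let $n\ge 0$, $\mathbb{T}^n=(\mathbb{R}/\mathbb{Z})^n$, $s\in\mathbb{R}$, and let $a:\mathbb{T}^n\to[0,\infty]$ be lower semicontinuous. For $\sigma\in\mathbb{R}$ let $\dot H^{\sigma}_{\mathrm{av}}(\mathbb{T}^n)$ be the real Hilbert space of real-valued distributions $u=\sum_{m\in\mathbb{Z}^n\setminus\{0\}}a_m e^{2\pi i m\cdot x}$ (convergence in $\mathcal{D}'(\mathbb{T}^n)$) with $\|u\|^2=\sum_{m\ne0}|m|^{2\sigma}|a_m|^2<\infty$, with inner product $((u,v))_\sigma=\sum_{m\neq 0}|m|^{2\sigma}a_m\overline{b_m}$, where $b_m$ are the coefficients of $v$. For a real distribution $u$ on $\mathbb{T}^n$ put $$TV_a(u)=\sup\{-\langle u,\operatorname{div}\varphi\rangle : \varphi\in C^\infty(\mathbb{T}^n)^n,\ |\varphi(x)|\le a(x)\text{ for all }x\in\mathbb{T}^n\}\in[0,\infty].$$ Let $H=\dot H^{-s}_{\mathrm{av}}(\mathbb{T}^n)$ and $D(TV_a)=\{v\in H: TV_a(v)<\infty\}$. For $v\in D(TV_a)$ let $\partial_H TV_a(v)$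 be the set of $f\in H$ with $TV_a(v+h)-TV_a(v)\ge ((h,f))_{-s}$ for all $h\in H$; let $\partial_H TV_a(v)=\emptyset$ for $v\in H\setminus D(TV_a)$. A solution with initial datum $u_0\in H$ is a function $u\in C([0,\infty),H)$ with time derivative $u_t\in\bigcap_{\delta>0}L^2((\delta,\infty),H)$ (i.e. $u(t)-u(\tau)=\int_\tau^t u_t\,dr$ for $0<\tau\le t$) such that $$u_t(t)\in-\partial_H TV_a(u(t))\quad\text{for a.e. }t>0,\qquad u(0)=u_0.$$ Then: (i) for every $u_0$ in the closure of $D(TV_a)$ in $H$ there is exactly one solution with initial datum $u_0$; (ii) if $\int_{\mathbb{T}^n}a\,dx<\infty$ (in particular if $a$ is bounded), then for every $u_0\in H$ there is exactly one solution with initial datum $u_0$. This is the rigorous meaning of the equation $u_t=(-\Delta)^s\operatorname{div}(a\nabla u/|\nabla u|)$ with initial datum $u_0$. -/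

import Mathlib

open Set Filter Topology MeasureTheory
open scoped ENNReal NNReal ContDiff

noncomputable section

/-! ## Smooth functions and distributions on the flat torus `ℝⁿ / ℤⁿ` -/

/-- The covering map `ℝⁿ → 𝕋ⁿ = (ℝ/ℤ)ⁿ`. -/
def torusCover (n : ℕ) (x : Fin n → ℝ) : UnitAddTorus (Fin n) :=
  fun i => (x i : UnitAddCircle)

/-- `C^∞(𝕋ⁿ; ℝ)`: real functions on the torus whose periodic lift to `ℝⁿ` is smooth. -/
def SmoothTorus (n : ℕ) : Submodule ℝ (UnitAddTorus (Fin n) → ℝ) where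
  carrier := {φ | ContDiff ℝ ∞ (fun x => φ (torusCover n x))}
  zero_mem' := by
    change ContDiff ℝ ∞ (fun _ : Fin n → ℝ => (0 : ℝ))
    exact contDiff_const
  add_mem' := by
    intro f g hf hg
    rw [mem_ofPred_eq] at hf hg ⊢
    exact hf.add hg
  smul_mem' := by
    intro c f hf
    rw [mem_ofPred_eq] at hf ⊢
    exact contDiff_const.mul hf

/-- The partial derivative `∂f/∂xᵢ` of a function on the torus. -/
def torusPartial {n : ℕ} (i : Fin n) (f : UnitAddTorus (Fin n) → ℝ) :
    UnitAddTorus (Fin n) → ℝ :=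
  fun x => deriv (fun h : ℝ => f (x + torusCover n (Pi.single i h))) 0

theorem torusCover_add {n : ℕ} (x y : Fin n → ℝ) :
    torusCover n (x + y) = torusCover n x + torusCover n y := rfl

theorem torusPartial_mem {n : ℕ} (i : Fin n) {f : UnitAddTorus (Fin n) → ℝ}
    (hf : f ∈ SmoothTorus n) : torusPartial i f ∈ SmoothTorus n := by
  have hf' : ContDiff ℝ ∞ (fun x => f (torusCover n x)) := hf
  have key : (fun x => torusPartial i f (torusCover n x)) =
      fun x => fderiv ℝ (fun x => f (torusCover n x)) x (Pi.single i 1) := by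
    funext x
    have h1 : HasDerivAt (fun h : ℝ => x + h • (Pi.single i (1 : ℝ) : Fin n → ℝ))
        (Pi.single i (1 : ℝ) : Fin n → ℝ) 0 := by
      simpa using ((hasDerivAt_id (0 : ℝ)).smul_const
        (Pi.single i (1 : ℝ) : Fin n → ℝ)).const_add x
    have h2 : HasFDerivAt (fun x => f (torusCover n x))
        (fderiv ℝ (fun x => f (torusCover n x)) x)
        (x + (0 : ℝ) • (Pi.single i (1 : ℝ) : Fin n → ℝ)) := by
      simpa using (hf'.differentiable (by simp) x).hasFDerivAt
    have h3 := (h2.comp_hasDerivAt (0 : ℝ) h1).deriv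
    rw [← h3]
    unfold torusPartial
    congr 1
    funext h
    have hs : (Pi.single i h : Fin n → ℝ) = h • (Pi.single i (1 : ℝ) : Fin n → ℝ) := by
      rw [← Pi.single_smul]; simp
    simp only [Function.comp_apply, torusCover_add, hs]
  change ContDiff ℝ ∞ (fun x => torusPartial i f (torusCover n x))
  rw [key]
  exact (hf'.fderiv_right (m := ∞) (by simp)).clm_apply contDiff_const

/-- The divergence `div φ = ∑ᵢ ∂φᵢ/∂xᵢ` of a smooth vector field on the torus. -/
def torusDiv {n : ℕ} (φ : Fin n → SmoothTorus n) : SmoothTorus n :=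
  ∑ i, ⟨torusPartial i (φ i), torusPartial_mem i (φ i).2⟩

/-- `𝒟'(𝕋ⁿ)`: real-valued distributions on the torus, i.e. the linear functionals on
`C^∞(𝕋ⁿ; ℝ)` that are continuous for the Fréchet topology given by the seminorms
`φ ↦ max_{k ≤ N} sup |D^k φ|`. -/
def TorusDistribution (n : ℕ) : Submodule ℝ (SmoothTorus n →ₗ[ℝ] ℝ) where
  carrier := {u | ∃ (N : ℕ) (C : ℝ), ∀ (φ : SmoothTorus n) (M : ℝ),
    (∀ k ≤ N, ∀ x, ‖iteratedFDeriv ℝ k (fun y => φ.1 (torusCover n y)) x‖ ≤ M) →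
      |u φ| ≤ C * M}
  zero_mem' := ⟨0, 0, fun φ M _ => by simp⟩
  add_mem' := by
    rintro u v ⟨N, C, hu⟩ ⟨N', C', hv⟩
    refine ⟨max N N', C + C', fun φ M h => ?_⟩
    have h1 := hu φ M fun k hk => h k (hk.trans (le_max_left _ _))
    have h2 := hv φ M fun k hk => h k (hk.trans (le_max_right _ _))
    calc |(u + v) φ| ≤ |u φ| + |v φ| := abs_add_le _ _
      _ ≤ C * M + C' * M := add_le_add h1 h2
      _ = (C + C') * M := by ring
  smul_mem' := by
    rintro c u ⟨N, C, hu⟩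
    refine ⟨N, |c| * C, fun φ M h => ?_⟩
    calc |(c • u) φ| = |c| * |u φ| := by simp [abs_mul]
      _ ≤ |c| * (C * M) := mul_le_mul_of_nonneg_left (hu φ M h) (abs_nonneg c)
      _ = |c| * C * M := by ring

/-! ## Fourier coefficients and the spaces `Ḣ^s_av(𝕋ⁿ)` -/

theorem mFourier_contDiff {n : ℕ} (m : Fin n → ℤ) :
    ContDiff ℝ ∞ (fun x : Fin n → ℝ => UnitAddTorus.mFourier m (torusCover n x)) := by
  have h : (fun x : Fin n → ℝ => UnitAddTorus.mFourier m (torusCover n x)) =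
      fun x => ∏ i, Complex.exp (2 * Real.pi * Complex.I * m i * ((x i : ℝ) : ℂ)) := by
    funext x
    simp [UnitAddTorus.mFourier, torusCover]
  rw [h]
  refine contDiff_prod fun i _ => ContDiff.cexp ?_
  exact contDiff_const.mul (Complex.ofRealCLM.contDiff.comp (contDiff_apply ℝ ℝ i))

/-- `x ↦ cos (2π m·x)`. -/
def torusCos {n : ℕ} (m : Fin n → ℤ) : SmoothTorus n :=
  ⟨fun x => (UnitAddTorus.mFourier m x).re,
    Complex.reCLM.contDiff.comp (mFourier_contDiff m)⟩

/-- `x ↦ sin (2π m·x)`. -/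
def torusSin {n : ℕ} (m : Fin n → ℤ) : SmoothTorus n :=
  ⟨fun x => (UnitAddTorus.mFourier m x).im,
    Complex.imCLM.contDiff.comp (mFourier_contDiff m)⟩

/-- The Fourier coefficient `⟨u, e^{-2πi m·x}⟩` of a real distribution on the torus. -/
def distFourierCoeff {n : ℕ} (m : Fin n → ℤ) : (SmoothTorus n →ₗ[ℝ] ℝ) →ₗ[ℝ] ℂ where
  toFun u := (u (torusCos m) : ℂ) - (u (torusSin m) : ℂ) * Complex.I
  map_add' u v := by simp; ring
  map_smul' c u := by simp; ring

/-- `|m|^s` for `m ∈ ℤⁿ`, with the Euclidean norm. -/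
def freqWeight {n : ℕ} (s : ℝ) (m : Fin n → ℤ) : ℝ := (∑ i, (m i : ℝ) ^ 2) ^ (s / 2)

theorem freqWeight_pos {n : ℕ} (s : ℝ) {m : Fin n → ℤ} (hm : m ≠ 0) : 0 < freqWeight s m := by
  obtain ⟨i, hi⟩ := Function.ne_iff.1 hm
  refine Real.rpow_pos_of_pos (Finset.sum_pos' (fun j _ => sq_nonneg _) ⟨i, Finset.mem_univ _, ?_⟩) _
  have : (m i : ℝ) ≠ 0 := by exact_mod_cast hi
  positivity

/-- The real space `Ḣ^s_av(𝕋ⁿ)`: real distributions `u = ∑_{m ≠ 0} a_m e^{2πi m·x}` (convergence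
in `𝒟'`) with `∑_{m ≠ 0} |m|^{2s} |a_m|² < ∞`.  The `a_m` are the Fourier coefficients of `u`, the
one at `m = 0` vanishes, and `mFourierCoeff φ (-m) = ∫ e^{2πi m·x} φ(x) dx`. -/
def HomSobolev (n : ℕ) (s : ℝ) : Submodule ℝ (SmoothTorus n →ₗ[ℝ] ℝ) where
  carrier := {u | u ∈ TorusDistribution n ∧ distFourierCoeff 0 u = 0 ∧
    Memℓp (fun m : Fin n → ℤ => freqWeight s m • distFourierCoeff m u) 2 ∧
    ∀ φ : SmoothTorus n, HasSum (fun m : Fin n → ℤ =>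
      distFourierCoeff m u * UnitAddTorus.mFourierCoeff (fun x => (φ.1 x : ℂ)) (-m))
      (u φ : ℂ)}
  zero_mem' := by
    refine ⟨zero_mem _, map_zero _, ?_, fun φ => ?_⟩
    · simp only [map_zero, smul_zero]
      exact zero_memℓp
    · simp [hasSum_zero]
  add_mem' := by
    rintro u v ⟨hu1, hu0, hu2, hu⟩ ⟨hv1, hv0, hv2, hv⟩
    refine ⟨add_mem hu1 hv1, by simp [hu0, hv0], ?_, fun φ => ?_⟩
    · simp only [map_add, smul_add]
      exact hu2.add hv2
    · simpa [add_mul] using (hu φ).add (hv φ)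
  smul_mem' := by
    rintro c u ⟨hu1, hu0, hu2, hu⟩
    refine ⟨Submodule.smul_mem _ c hu1, by simp [hu0], ?_, fun φ => ?_⟩
    · have : (fun m : Fin n → ℤ => freqWeight s m • distFourierCoeff m (c • u)) =
          c • fun m : Fin n → ℤ => freqWeight s m • distFourierCoeff m u := by
        funext m
        simp only [map_smul, Pi.smul_apply]
        exact smul_comm _ _ _
      rw [this]
      exact hu2.const_smul c
    · simpa [mul_assoc] using (hu φ).mul_left (c : ℂ)

/-- The weighted coefficient map `u ↦ (|m|^s a_m)_m`, from `Ḣ^s_av` to `ℓ²(ℤⁿ; ℂ)`. -/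
def HomSobolev.toL2 (n : ℕ) (s : ℝ) :
    HomSobolev n s →ₗ[ℝ] lp (fun _ : Fin n → ℤ => ℂ) 2 where
  toFun u := ⟨fun m => freqWeight s m • distFourierCoeff m u.1, u.2.2.2.1⟩
  map_add' u v := by
    ext m
    exact (congrArg (freqWeight s m • ·) (map_add (distFourierCoeff m) u.1 v.1)).trans
      (smul_add _ _ _)
  map_smul' c u := by
    ext m
    simp [mul_left_comm]

theorem HomSobolev.toL2_injective (n : ℕ) (s : ℝ) :
    Function.Injective (HomSobolev.toL2 n s) := by
  rw [injective_iff_map_eq_zero]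
  intro u hu
  have hc : ∀ m, distFourierCoeff m u.1 = 0 := by
    intro m
    by_cases hm : m = 0
    · rw [hm]; exact u.2.2.1
    · have h1 : freqWeight s m • distFourierCoeff m u.1 = 0 :=
        congrFun (congrArg (fun w : lp (fun _ : Fin n → ℤ => ℂ) 2 => (w : (Fin n → ℤ) → ℂ)) hu) m
      exact (smul_eq_zero.1 h1).resolve_left (freqWeight_pos s hm).ne'
  apply Subtype.ext
  apply LinearMap.ext
  intro φ
  have h := u.2.2.2.2 φ
  simp only [hc, zero_mul] at h
  have h2 := h.unique hasSum_zero
  exact_mod_cast h2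

instance (n : ℕ) (s : ℝ) : NormedAddCommGroup (HomSobolev n s) :=
  NormedAddCommGroup.induced (HomSobolev n s) (lp (fun _ : Fin n → ℤ => ℂ) 2)
    (HomSobolev.toL2 n s) (HomSobolev.toL2_injective n s)

instance (n : ℕ) (s : ℝ) : InnerProductSpace ℝ (HomSobolev n s) :=
  InnerProductSpace.induced (HomSobolev.toL2 n s)

/-- The inner product of `Ḣ^s_av(𝕋ⁿ)` is `∑_m |m|^{2s} a_m \bar b_m` (a real number, since `u` and
`v` are real). -/
theorem HomSobolev.inner_eq (n : ℕ) (s : ℝ) (u v : HomSobolev n s) :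
    inner ℝ u v = ∑' m : Fin n → ℤ, freqWeight s m ^ 2 *
      (distFourierCoeff m u.1 * (starRingEnd ℂ) (distFourierCoeff m v.1)).re := by
  change inner ℝ (HomSobolev.toL2 n s u) (HomSobolev.toL2 n s v) = _
  rw [lp.inner_eq_tsum]
  refine tsum_congr fun m => ?_
  simp [HomSobolev.toL2, Complex.inner]
  ring

/-! ## Weighted total variation and gradient flows -/

/-- The weighted total variation
`TV_a(u) = sup { -⟨u, div φ⟩ : φ ∈ C^∞(𝕋ⁿ)ⁿ, |φ(x)| ≤ a(x) for all x }` of a distribution. -/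
def weightedTV {n : ℕ} (a : UnitAddTorus (Fin n) → ℝ≥0∞) (u : SmoothTorus n →ₗ[ℝ] ℝ) : EReal :=
  ⨆ (φ : Fin n → SmoothTorus n)
    (_ : ∀ x, ENNReal.ofReal (Real.sqrt (∑ i, (φ i).1 x ^ 2)) ≤ a x),
    ((-(u (torusDiv φ)) : ℝ) : EReal)

section GradientFlow

variable {H : Type*} [NormedAddCommGroup H] [InnerProductSpace ℝ H]

/-- `D(E) = {v : E(v) < ∞}`. -/
def effectiveDomain (E : H → EReal) : Set H := {v | E v < ⊤}

/-- The subdifferential `∂_H E(v)` (empty if `v ∉ D(E)`). -/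
def subdifferential (E : H → EReal) (v : H) : Set H :=
  {f | v ∈ effectiveDomain E ∧ ∀ h : H, E v + ((inner ℝ h f : ℝ) : EReal) ≤ E (v + h)}

/-- `u ∈ C([0,∞), H)` has a time derivative `u_t ∈ ⋂_{δ>0} L²((δ,∞), H)`, that is,
`u(t) - u(τ) = ∫_τ^t u_t` for `0 < τ ≤ t`, and it solves `u_t ∈ -∂_H E(u)` for a.e. `t > 0`,
`u(0) = u₀`. -/
def IsGradientFlow (E : H → EReal) (u₀ : H) (u : C(ℝ≥0, H)) : Prop :=
  u 0 = u₀ ∧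
  ∃ ut : ℝ → H,
    (∀ δ : ℝ, 0 < δ → MemLp ut 2 (volume.restrict (Ioi δ))) ∧
    (∀ τ t : ℝ≥0, 0 < τ → τ ≤ t → u t - u τ = ∫ r in (τ : ℝ)..t, ut r) ∧
    ∀ᵐ t ∂(volume.restrict (Ioi (0 : ℝ))), -ut t ∈ subdifferential E (u t.toNNReal)

end GradientFlow

end

/-! On `H` the functional `TV_a` is a supremum of continuous linear functionals `u ↦ -⟨u, div φ⟩`.
By Riesz each is represented by a vector of `H`, so `TV_a` is the support function `E` of a set `K₀
∋ 0`, and equally of its closed convex hull `K`. If `f ∈ K` maximizes `⟪·, v⟫` over `K`, then `f ∈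
∂E(v)`. The evolution problem therefore reduces to a statement about closed convex sets in a
separable Hilbert space (`existsUnique_isGradientFlow`).

Existence follows Crandall and Liggett. The resolvent is `x ↦ x - l P_K(x / l)`, with `P_K` the
metric projection. It is nonexpansive, and `sq_norm_iterate_prox_sub_iterate_prox_le` makes the
implicit Euler schemes Cauchy as the step tends to zero. The limit `S(t)` is a contraction semiflow
on the closure of the domain of the subdifferential, which contains `D(E)`. Since `E` is positively
homogeneous of degree one, `S(t)(c x) = c S(t / c) x`; with contractivity this gives `‖S(t)x -
S(s)x‖ ≤ 2‖x‖(t - s) / t` (`norm_supportFlow_sub_supportFlow_le`). Hence the orbit is Lipschitz away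
from `t = 0` and has a.e. a weak derivative of norm at most `2‖x‖ / t`, which is square integrable
on every `(δ, ∞)`.

The equation is recovered in `supports_neg_weak_derivative`: negated difference quotients lie in `K`
because they are limits of averages of elements of `K`, and maximality comes from an energy
inequality for `‖u‖² / 2`. Uniqueness holds because monotonicity of `∂E` makes the distance of two
solutions nonincreasing.

It remains to prove by Fourier series that `H` is complete and separable and that evaluation at a
test function is bounded. If `∫ a < ∞`, trigonometric polynomials have finite `TV_a` and are dense,
so every initial datum is allowed. -/

noncomputable section

/-! ### Resolvents and implicit Euler schemes for support functions. -/

section SupportFunctionFlow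

open scoped InnerProductSpace

variable {H : Type*} [NormedAddCommGroup H] [InnerProductSpace ℝ H] {K : Set H}

/-- `K` is closed, convex and contains the origin. -/
structure IsClosedConvexZero (K : Set H) : Prop where
  convex : Convex ℝ K
  closed : IsClosed K
  zero_mem : (0 : H) ∈ K

/-- `f ∈ K` maximizes `⟪·, x⟫` over `K`; equivalently, `f` is a subgradient at `x` of the support
function of `K`. -/
def Supports (K : Set H) (f x : H) : Prop := f ∈ K ∧ ∀ g ∈ K, ⟪g, x⟫_ℝ ≤ ⟪f, x⟫_ℝ

theorem Supports.inner_nonneg (hK : IsClosedConvexZero K) {f x : H} (h : Supports K f x) :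
    0 ≤ ⟪f, x⟫_ℝ := by
  simpa using h.2 0 hK.zero_mem

theorem Supports.monotone {f g x y : H} (hf : Supports K f x) (hg : Supports K g y) :
    0 ≤ ⟪f - g, x - y⟫_ℝ := by
  have h1 := hf.2 g hg.1
  have h2 := hg.2 f hf.1
  simp only [inner_sub_left, inner_sub_right]
  linarith

theorem Supports.smul {f x : H} (hf : Supports K f x) {c : ℝ} (hc : 0 ≤ c) :
    Supports K f (c • x) := by
  refine ⟨hf.1, fun g hg => ?_⟩
  simp only [inner_smul_right]
  exact mul_le_mul_of_nonneg_left (hf.2 g hg) hc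

theorem Supports.zero (hK : IsClosedConvexZero K) : Supports K 0 (0 : H) :=
  ⟨hK.zero_mem, fun g _ => by simp⟩

/-- Expanding the square on the right, the cross term is nonnegative by monotonicity. This is the
nonexpansiveness of the resolvent. -/
theorem Supports.norm_sub_le {f g x y : H} (hf : Supports K f x) (hg : Supports K g y) {l : ℝ}
    (hl : 0 ≤ l) : ‖x - y‖ ≤ ‖(x + l • f) - (y + l • g)‖ := by
  have h1 := mul_nonneg hl (hf.monotone hg)
  have h2 : (x + l • f) - (y + l • g) = (x - y) + l • (f - g) := by module
  have h3 : ‖(x + l • f) - (y + l • g)‖ ^ 2 =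
      ‖x - y‖ ^ 2 + 2 * (l * ⟪f - g, x - y⟫_ℝ) + ‖l • (f - g)‖ ^ 2 := by
    rw [h2, norm_add_sq_real, inner_smul_right, real_inner_comm]
  refine le_of_sq_le_sq ?_ (norm_nonneg _)
  rw [h3]
  nlinarith [sq_nonneg ‖l • (f - g)‖]

/-- The proximal map `(1 + l ∂E)⁻¹` of the support function `E` of `K`. -/
def prox (K : Set H) (l : ℝ) (x : H) : H :=
  Classical.epsilon fun y => Supports K (l⁻¹ • (x - y)) y

theorem prox_add_smul_inv {l : ℝ} (hl : 0 < l) (x : H) :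
    prox K l x + l • (l⁻¹ • (x - prox K l x)) = x := by
  rw [smul_smul, mul_inv_cancel₀ hl.ne', one_smul, add_sub_cancel]

theorem norm_convexComb_sq_le {θ : ℝ} (h0 : 0 ≤ θ) (h1 : θ ≤ 1) (x y : H) :
    ‖θ • x + (1 - θ) • y‖ ^ 2 ≤ θ * ‖x‖ ^ 2 + (1 - θ) * ‖y‖ ^ 2 := by
  have := (convexOn_univ_norm (E := H)).pow (fun _ _ => norm_nonneg _) 2
  simpa using this.2 (mem_univ x) (mem_univ y) h0 (sub_nonneg.2 h1) (by ring)

theorem floor_div_mul_mem {l t : ℝ} (hl : 0 < l) (ht : 0 ≤ t) :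
    (⌊t / l⌋₊ : ℝ) * l ≤ t ∧ t < (⌊t / l⌋₊ : ℝ) * l + l := by
  have h1 := Nat.floor_le (div_nonneg ht hl.le)
  have h2 := Nat.lt_floor_add_one (t / l)
  rw [le_div_iff₀ hl] at h1
  rw [div_lt_iff₀ hl] at h2
  exact ⟨h1, by linarith⟩

/-- The closure of the domain of the subdifferential of the support function of `K`. -/
def flowDomain (K : Set H) : Set H := closure {x | ∃ f, Supports K f x}

theorem smul_mem_flowDomain {c : ℝ} (hc : 0 ≤ c) {x : H} (hx : x ∈ flowDomain K) :
    c • x ∈ flowDomain K :=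
  map_mem_closure (continuous_const_smul c) hx fun _ ⟨f, hf⟩ => ⟨f, hf.smul hc⟩

theorem zero_mem_flowDomain (hK : IsClosedConvexZero K) : (0 : H) ∈ flowDomain K :=
  subset_closure ⟨0, Supports.zero hK⟩

variable [CompleteSpace H]

/-- Moreau decomposition: with `f` the projection of `l⁻¹ • x` onto `K`, take `y = x - l • f`. The
variational inequality of the projection says exactly that `f` supports `K` in the direction `y`. -/
theorem exists_supports_prox (hK : IsClosedConvexZero K) {l : ℝ} (hl : 0 < l) (x : H) :
    ∃ y, Supports K (l⁻¹ • (x - y)) y := by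
  obtain ⟨f, hf, h⟩ := exists_norm_eq_iInf_of_complete_convex ⟨0, hK.zero_mem⟩
    hK.closed.isComplete hK.convex (l⁻¹ • x)
  rw [norm_eq_iInf_iff_real_inner_le_zero hK.convex hf] at h
  have e : l⁻¹ • (x - (x - l • f)) = f := by
    rw [sub_sub_cancel, smul_smul, inv_mul_cancel₀ hl.ne', one_smul]
  refine ⟨x - l • f, ?_⟩
  rw [e]
  refine ⟨hf, fun g hg => ?_⟩
  have h1 := h g hg
  have e2 : x - l • f = l • (l⁻¹ • x - f) := by
    rw [smul_sub, smul_smul, mul_inv_cancel₀ hl.ne', one_smul]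
  rw [e2, inner_smul_right, inner_smul_right, real_inner_comm _ g, real_inner_comm _ f]
  rw [inner_sub_right] at h1
  exact mul_le_mul_of_nonneg_left (by linarith) hl.le

theorem supports_prox (hK : IsClosedConvexZero K) {l : ℝ} (hl : 0 < l) (x : H) :
    Supports K (l⁻¹ • (x - prox K l x)) (prox K l x) :=
  Classical.epsilon_spec (exists_supports_prox hK hl x)

theorem norm_prox_sub_le (hK : IsClosedConvexZero K) {l : ℝ} (hl : 0 < l) (x y : H) :
    ‖prox K l x - prox K l y‖ ≤ ‖x - y‖ := by
  have h := (supports_prox hK hl x).norm_sub_le (supports_prox hK hl y) hl.le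
  rwa [prox_add_smul_inv hl, prox_add_smul_inv hl] at h

theorem prox_eq_of_supports (hK : IsClosedConvexZero K) {l : ℝ} (hl : 0 < l) {f x y : H}
    (hf : Supports K f y) (h : y + l • f = x) : prox K l x = y := by
  have h1 := (supports_prox hK hl x).norm_sub_le hf hl.le
  rw [prox_add_smul_inv hl, h, sub_self, norm_zero] at h1
  exact sub_eq_zero.1 (norm_le_zero_iff.1 h1)

/-- Resolvent identity, needed to compare schemes with different steps: the point `prox K l x` and
its subgradient are kept, and only the step becomes `m`. -/
theorem prox_convexComb (hK : IsClosedConvexZero K) {l m : ℝ} (hl : 0 < l) (hm : 0 < m) (x : H) :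
    prox K m ((m / l) • x + (1 - m / l) • prox K l x) = prox K l x := by
  refine prox_eq_of_supports hK hm (supports_prox hK hl x) ?_
  rw [smul_smul, div_eq_mul_inv]
  module

theorem norm_prox_sub_self_le (hK : IsClosedConvexZero K) {l : ℝ} (hl : 0 < l) {f x : H}
    (hf : Supports K f x) : ‖prox K l x - x‖ ≤ l * ‖f‖ := by
  have h := norm_prox_sub_le hK hl x (x + l • f)
  rw [prox_eq_of_supports hK hl hf rfl, sub_add_cancel_left, norm_neg, norm_smul,
    Real.norm_of_nonneg hl.le] at h
  exact h

/-- A subgradient at `x` is also one at `c • x`, so scaling the point by `c` amounts to scaling the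
step by `1 / c`. -/
theorem prox_smul (hK : IsClosedConvexZero K) {l c : ℝ} (hl : 0 < l) (hc : 0 < c) (x : H) :
    prox K l (c • x) = c • prox K (l / c) x := by
  refine prox_eq_of_supports hK hl ((supports_prox hK (div_pos hl hc) x).smul hc.le) ?_
  rw [smul_smul, inv_div, mul_div_cancel₀ _ hl.ne', ← smul_add, add_sub_cancel]

theorem prox_zero (hK : IsClosedConvexZero K) {l : ℝ} (hl : 0 < l) : prox K l (0 : H) = 0 :=
  prox_eq_of_supports hK hl (Supports.zero hK) (by simp)

theorem norm_iterate_prox_sub_le (hK : IsClosedConvexZero K) {l : ℝ} (hl : 0 < l) (x y : H)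
    (k : ℕ) : ‖(prox K l)^[k] x - (prox K l)^[k] y‖ ≤ ‖x - y‖ := by
  induction k with
  | zero => simp
  | succ k ih =>
    rw [Function.iterate_succ_apply', Function.iterate_succ_apply']
    exact (norm_prox_sub_le hK hl _ _).trans ih

theorem norm_iterate_prox_sub_self_le (hK : IsClosedConvexZero K) {l : ℝ} (hl : 0 < l) {f x : H}
    (hf : Supports K f x) (k : ℕ) : ‖(prox K l)^[k] x - x‖ ≤ k * l * ‖f‖ := by
  induction k with
  | zero => simp
  | succ k ih =>
    have h1 : ‖(prox K l)^[k] (prox K l x) - (prox K l)^[k] x‖ ≤ l * ‖f‖ :=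
      (norm_iterate_prox_sub_le hK hl _ _ k).trans (norm_prox_sub_self_le hK hl hf)
    rw [Function.iterate_succ_apply]
    have h2 := norm_sub_le_norm_sub_add_norm_sub ((prox K l)^[k] (prox K l x))
      ((prox K l)^[k] x) x
    push_cast
    linarith

/-- With `θ = m / l`, the resolvent identity and convexity of the squared norm bound the entry `(i +
1, j + 1)` by `θ` times the entry `(i, j)` plus `1 - θ` times the entry `(i + 1, j)`. The right-hand
side solves this recursion with equality and dominates the boundary values at `i = 0` and `j = 0`.
-/
theorem sq_norm_iterate_prox_sub_iterate_prox_le (hK : IsClosedConvexZero K) {l m : ℝ}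
    (hm : 0 < m) (hml : m ≤ l) {f x : H} (hf : Supports K f x) (i j : ℕ) :
    ‖(prox K l)^[i] x - (prox K m)^[j] x‖ ^ 2 ≤
      ‖f‖ ^ 2 * ((i * l - j * m) ^ 2 + j * m * (l - m)) := by
  have hl : 0 < l := hm.trans_le hml
  induction j generalizing i with
  | zero =>
    have h := pow_le_pow_left₀ (norm_nonneg _) (norm_iterate_prox_sub_self_le hK hl hf i) 2
    simp only [Function.iterate_zero, id_eq, Nat.cast_zero]
    nlinarith
  | succ j ih =>
    rcases i with _ | i
    · have h := pow_le_pow_left₀ (norm_nonneg _)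
        (norm_iterate_prox_sub_self_le hK hm hf (j + 1)) 2
      simp only [Function.iterate_zero, id_eq, Nat.cast_zero]
      rw [norm_sub_rev]
      have h2 : 0 ≤ ‖f‖ ^ 2 * (((j + 1 : ℕ) : ℝ) * m * (l - m)) := by
        have := sub_nonneg.2 hml
        positivity
      nlinarith
    · set y := (prox K l)^[i] x with hy
      set z := (prox K m)^[j] x with hz
      have hθ : m / l ≤ 1 := (div_le_one hl).2 hml
      have hθ0 : 0 ≤ m / l := by positivity
      have e1 : (prox K l)^[i + 1] x = prox K l y := Function.iterate_succ_apply' _ _ _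
      have e2 : (prox K m)^[j + 1] x = prox K m z := Function.iterate_succ_apply' _ _ _
      have h1 : ‖prox K l y - prox K m z‖ ≤
          ‖(m / l) • (y - z) + (1 - m / l) • (prox K l y - z)‖ := by
        have := norm_prox_sub_le hK hm ((m / l) • y + (1 - m / l) • prox K l y) z
        rw [prox_convexComb hK hl hm] at this
        convert this using 2
        module
      have h2 := (pow_le_pow_left₀ (norm_nonneg _) h1 2).trans (norm_convexComb_sq_le hθ0 hθ _ _)
      have h3 := ih i
      have h4 := ih (i + 1)
      rw [e1] at h4
      rw [e1, e2]
      refine h2.trans ((add_le_add (mul_le_mul_of_nonneg_left h3 hθ0)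
        (mul_le_mul_of_nonneg_left h4 (sub_nonneg.2 hθ))).trans (le_of_eq ?_))
      push_cast
      field_simp
      ring

/-- The time-`t` value of the implicit Euler scheme with step `l` for `u' ∈ -∂E(u)`. -/
def eulerScheme (K : Set H) (l t : ℝ) (x : H) : H := (prox K l)^[⌊t / l⌋₊] x

theorem sq_norm_eulerScheme_sub_le (hK : IsClosedConvexZero K) {l m t : ℝ} (hm : 0 < m)
    (hml : m ≤ l) (ht : 0 ≤ t) {f x : H} (hf : Supports K f x) :
    ‖eulerScheme K l t x - eulerScheme K m t x‖ ^ 2 ≤ ‖f‖ ^ 2 * (l ^ 2 + t * l) := by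
  refine (sq_norm_iterate_prox_sub_iterate_prox_le hK hm hml hf _ _).trans
    (mul_le_mul_of_nonneg_left ?_ (sq_nonneg _))
  obtain ⟨h1, h2⟩ := floor_div_mul_mem (hm.trans_le hml) ht
  obtain ⟨h3, h4⟩ := floor_div_mul_mem hm ht
  -- Both rounded times lie within `l` below `t`, so they differ by at most `l`.
  refine add_le_add (sq_le_sq' (by linarith) (by linarith)) ?_
  have : 0 ≤ (⌊t / m⌋₊ : ℝ) * m := by positivity
  nlinarith

theorem norm_eulerScheme_sub_le (hK : IsClosedConvexZero K) {l : ℝ} (hl : 0 < l) (t : ℝ)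
    (x y : H) : ‖eulerScheme K l t x - eulerScheme K l t y‖ ≤ ‖x - y‖ :=
  norm_iterate_prox_sub_le hK hl x y _

theorem norm_eulerScheme_sub_self_le (hK : IsClosedConvexZero K) {l t : ℝ} (hl : 0 < l)
    (ht : 0 ≤ t) {f x : H} (hf : Supports K f x) : ‖eulerScheme K l t x - x‖ ≤ t * ‖f‖ :=
  (norm_iterate_prox_sub_self_le hK hl hf _).trans
    (mul_le_mul_of_nonneg_right (floor_div_mul_mem hl ht).1 (norm_nonneg _))

theorem eulerScheme_smul (hK : IsClosedConvexZero K) {l c : ℝ} (hl : 0 < l) (hc : 0 < c) (t : ℝ)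
    (x : H) : eulerScheme K l t (c • x) = c • eulerScheme K (l / c) (t / c) x := by
  have h : ∀ k : ℕ, (prox K l)^[k] (c • x) = c • (prox K (l / c))^[k] x := by
    intro k
    induction k with
    | zero => simp
    | succ k ih =>
      rw [Function.iterate_succ_apply', Function.iterate_succ_apply', ih, prox_smul hK hl hc]
  rw [eulerScheme, eulerScheme, div_div_div_cancel_right₀ hc.ne', h]

/-- Each step subtracts `l` times an element of `K`, and by convexity the average of the `j`
elements used is again in `K`. -/
theorem exists_iterate_prox_sub_eq_smul (hK : IsClosedConvexZero K) {l : ℝ} (hl : 0 < l) (x : H)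
    (i j : ℕ) : ∃ g ∈ K, (prox K l)^[i] x - (prox K l)^[i + j] x = (j * l) • g := by
  induction j with
  | zero => exact ⟨0, hK.zero_mem, by simp⟩
  | succ j ih =>
    obtain ⟨g, hg, h⟩ := ih
    set y := (prox K l)^[i + j] x with hy
    have h1 := supports_prox hK hl y
    have h2 := prox_add_smul_inv (K := K) hl y
    set f := l⁻¹ • (y - prox K l y) with hf
    have e : (prox K l)^[i + (j + 1)] x = prox K l y := by
      rw [← add_assoc, Function.iterate_succ_apply']
    refine ⟨((j : ℝ) / (j + 1)) • g + ((1 : ℝ) / (j + 1)) • f,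
      hK.convex hg h1.1 (by positivity) (by positivity) (by field_simp), ?_⟩
    have h3 : (prox K l)^[i] x = prox K l y + l • f + ((j : ℝ) * l) • g := by
      rw [h2, ← h]; abel
    rw [e, h3, smul_add, smul_smul _ _ f, smul_smul _ _ g]
    push_cast
    have e1 : ((j : ℝ) + 1) * l * (j / (j + 1)) = j * l := by field_simp
    have e2 : ((j : ℝ) + 1) * l * (1 / (j + 1)) = l := by field_simp
    rw [e1, e2]
    abel

/-- Discrete energy inequality. One step `z = y - l • f` lowers `‖·‖² / 2` by at least `l * ⟪f, z⟫`,
and `f` is maximal at `z`. All `j` steps can be tested at the last point because the support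
function decreases along the scheme. -/
theorem norm_iterate_prox_sq_sub_le (hK : IsClosedConvexZero K) {l : ℝ} (hl : 0 < l) (x : H)
    (i j : ℕ) : ∀ f ∈ K, ‖(prox K l)^[i + j] x‖ ^ 2 / 2 - ‖(prox K l)^[i] x‖ ^ 2 / 2 ≤
      -(j * l * ⟪f, (prox K l)^[i + j] x⟫_ℝ) := by
  induction j with
  | zero => intro f _; simp
  | succ j ih =>
    intro g hg
    set y := (prox K l)^[i + j] x with hy
    have h1 := supports_prox hK hl y
    have h2 := prox_add_smul_inv (K := K) hl y
    set f := l⁻¹ • (y - prox K l y) with hf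
    have e : (prox K l)^[i + (j + 1)] x = prox K l y := by
      rw [← add_assoc, Function.iterate_succ_apply']
    -- The induction hypothesis is applied to the new subgradient `f` instead of `g`, since `⟪g, z⟫
    -- ≤ ⟪f, z⟫ ≤ ⟪f, y⟫`.
    have h3 := ih f h1.1
    set z := prox K l y with hz
    have h4 : ⟪f, z⟫_ℝ ≤ ⟪f, y⟫_ℝ := by
      rw [← h2, inner_add_right, inner_smul_right, real_inner_self_eq_norm_sq]
      have := mul_nonneg hl.le (sq_nonneg ‖f‖)
      linarith
    have h5 : ‖y‖ ^ 2 = ‖z‖ ^ 2 + 2 * (l * ⟪f, z⟫_ℝ) + ‖l • f‖ ^ 2 := by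
      rw [← h2, norm_add_sq_real, inner_smul_right, real_inner_comm]
    have h6 : ((j + 1 : ℕ) : ℝ) * l * ⟪g, z⟫_ℝ ≤ ((j + 1 : ℕ) : ℝ) * l * ⟪f, z⟫_ℝ :=
      mul_le_mul_of_nonneg_left (h1.2 g hg) (by positivity)
    have h7 : (j : ℝ) * l * ⟪f, z⟫_ℝ ≤ (j : ℝ) * l * ⟪f, y⟫_ℝ :=
      mul_le_mul_of_nonneg_left h4 (by positivity)
    rw [e]
    push_cast at h6 ⊢
    have h8 := sq_nonneg ‖l • f‖
    linarith

/-! ### The limit flow: contraction, homogeneity and regularity in time. -/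

/-- The gradient flow of the support function of `K`. -/
def supportFlow (K : Set H) (t : ℝ) (x : H) : H :=
  limUnder (𝓝[>] (0 : ℝ)) fun l => eulerScheme K l t x

theorem exists_norm_eulerScheme_sub_lt (hK : IsClosedConvexZero K) {t : ℝ} (ht : 0 ≤ t) {x : H}
    (hx : x ∈ flowDomain K) {ε : ℝ} (hε : 0 < ε) : ∃ δ > 0, ∀ l m : ℝ, 0 < m → m ≤ l → l < δ →
      ‖eulerScheme K l t x - eulerScheme K m t x‖ < ε := by
  obtain ⟨y, ⟨f, hf⟩, hy⟩ := Metric.mem_closure_iff.1 hx (ε / 3) (by positivity)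
  have hlim : Tendsto (fun l : ℝ => ‖f‖ ^ 2 * (l ^ 2 + t * l)) (𝓝 0) (𝓝 0) := by
    have : Continuous fun l : ℝ => ‖f‖ ^ 2 * (l ^ 2 + t * l) := by fun_prop
    simpa using this.tendsto 0
  obtain ⟨δ, hδ, h⟩ := Metric.eventually_nhds_iff.1
    (hlim.eventually (gt_mem_nhds (show (0 : ℝ) < (ε / 3) ^ 2 by positivity)))
  refine ⟨δ, hδ, fun l m hm hml hl => ?_⟩
  have hl0 := hm.trans_le hml
  have h1 := h (y := l) (by rwa [Real.dist_eq, sub_zero, abs_of_pos hl0])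
  have h2 := lt_of_pow_lt_pow_left₀ 2 (by positivity)
    ((sq_norm_eulerScheme_sub_le hK hm hml ht hf).trans_lt h1)
  have h3 := norm_eulerScheme_sub_le hK hl0 t x y
  have h4 := norm_eulerScheme_sub_le hK hm t y x
  rw [dist_eq_norm] at hy
  rw [norm_sub_rev y x] at h4
  have h5 : eulerScheme K l t x - eulerScheme K m t x =
      (eulerScheme K l t x - eulerScheme K l t y) + (eulerScheme K l t y - eulerScheme K m t y) +
      (eulerScheme K m t y - eulerScheme K m t x) := by abel
  rw [h5]
  refine (norm_add₃_le).trans_lt ?_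
  linarith

theorem tendsto_eulerScheme (hK : IsClosedConvexZero K) {t : ℝ} (ht : 0 ≤ t) {x : H}
    (hx : x ∈ flowDomain K) :
    Tendsto (fun l => eulerScheme K l t x) (𝓝[>] 0) (𝓝 (supportFlow K t x)) := by
  refine tendsto_nhds_limUnder (cauchy_map_iff_exists_tendsto.1 ?_)
  rw [Metric.cauchy_iff]
  refine ⟨map_neBot, fun ε hε => ?_⟩
  obtain ⟨δ, hδ, h⟩ := exists_norm_eulerScheme_sub_lt hK ht hx hε
  refine ⟨_, image_mem_map (Ioo_mem_nhdsGT hδ), ?_⟩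
  rintro _ ⟨l, hl, rfl⟩ _ ⟨m, hm, rfl⟩
  rw [dist_eq_norm]
  rcases le_total m l with hml | hml
  · exact h l m hm.1 hml hl.2
  · rw [norm_sub_rev]
    exact h m l hl.1 hml hm.2

theorem norm_supportFlow_sub_le (hK : IsClosedConvexZero K) {t : ℝ} (ht : 0 ≤ t) {x y : H}
    (hx : x ∈ flowDomain K) (hy : y ∈ flowDomain K) :
    ‖supportFlow K t x - supportFlow K t y‖ ≤ ‖x - y‖ :=
  le_of_tendsto ((tendsto_eulerScheme hK ht hx).sub (tendsto_eulerScheme hK ht hy)).norm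
    (eventually_nhdsWithin_of_forall fun _ hl => norm_eulerScheme_sub_le hK hl t x y)

theorem supportFlow_zero_right (hK : IsClosedConvexZero K) {t : ℝ} (ht : 0 ≤ t) :
    supportFlow K t (0 : H) = 0 := by
  refine tendsto_nhds_unique (tendsto_eulerScheme hK ht (zero_mem_flowDomain hK))
    (tendsto_const_nhds.congr' (eventually_nhdsWithin_of_forall fun l hl => ?_))
  exact (Function.iterate_fixed (prox_zero hK hl) _).symm

theorem norm_supportFlow_le (hK : IsClosedConvexZero K) {t : ℝ} (ht : 0 ≤ t) {x : H}
    (hx : x ∈ flowDomain K) : ‖supportFlow K t x‖ ≤ ‖x‖ := by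
  simpa [supportFlow_zero_right hK ht] using
    norm_supportFlow_sub_le hK ht hx (zero_mem_flowDomain hK)

theorem supportFlow_zero_left (hK : IsClosedConvexZero K) {x : H} (hx : x ∈ flowDomain K) :
    supportFlow K 0 x = x := by
  refine tendsto_nhds_unique (tendsto_eulerScheme hK le_rfl hx) ?_
  simp [eulerScheme]

theorem supportFlow_smul (hK : IsClosedConvexZero K) {t c : ℝ} (ht : 0 ≤ t) (hc : 0 < c) {x : H}
    (hx : x ∈ flowDomain K) : supportFlow K t (c • x) = c • supportFlow K (t / c) x := by
  refine tendsto_nhds_unique (tendsto_eulerScheme hK ht (smul_mem_flowDomain hc.le hx)) ?_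
  have h1 : Tendsto (fun l : ℝ => l / c) (𝓝[>] 0) (𝓝[>] 0) := by
    refine tendsto_nhdsWithin_iff.2 ⟨?_, eventually_nhdsWithin_of_forall fun l hl => div_pos hl hc⟩
    simpa using ((continuous_id.div_const c).tendsto (0 : ℝ)).mono_left nhdsWithin_le_nhds
  refine (((tendsto_eulerScheme hK (div_nonneg ht hc.le) hx).comp h1).const_smul c).congr'
    (eventually_nhdsWithin_of_forall fun l hl => ?_)
  exact (eulerScheme_smul hK hl hc t x).symm

/-- Argument of Bénilan and Crandall. Homogeneity gives `S(s)((s / t) x) = (s / t) S(t) x`, so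
`S(t)x - S(s)x` is `(1 - s / t) S(t) x` plus `S(s)((s / t) x) - S(s)x`. Each term has norm at most
`(1 - s / t)‖x‖` by contractivity. -/
theorem norm_supportFlow_sub_supportFlow_le (hK : IsClosedConvexZero K) {s t : ℝ} (hs : 0 < s)
    (hst : s ≤ t) {x : H} (hx : x ∈ flowDomain K) :
    ‖supportFlow K t x - supportFlow K s x‖ ≤ 2 * ‖x‖ / t * (t - s) := by
  have ht := hs.trans_le hst
  have hc : 0 < s / t := div_pos hs ht
  have h1 := norm_supportFlow_sub_le hK hs.le (smul_mem_flowDomain hc.le hx) hx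
  have e : s / (s / t) = t := by field_simp
  rw [supportFlow_smul hK hs.le hc hx, e] at h1
  have h2 : ‖(s / t) • x - x‖ = (1 - s / t) * ‖x‖ := by
    have : (s / t) • x - x = -((1 - s / t) • x) := by module
    rw [this, norm_neg, norm_smul, Real.norm_of_nonneg (sub_nonneg.2 ((div_le_one ht).2 hst))]
  have h3 : ‖supportFlow K t x - (s / t) • supportFlow K t x‖ ≤ (1 - s / t) * ‖x‖ := by
    have : supportFlow K t x - (s / t) • supportFlow K t x =
      (1 - s / t) • supportFlow K t x := by module
    rw [this, norm_smul, Real.norm_of_nonneg (sub_nonneg.2 ((div_le_one ht).2 hst))]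
    exact mul_le_mul_of_nonneg_left (norm_supportFlow_le hK ht.le hx)
      (sub_nonneg.2 ((div_le_one ht).2 hst))
  have h4 := norm_sub_le_norm_sub_add_norm_sub (supportFlow K t x) ((s / t) • supportFlow K t x)
    (supportFlow K s x)
  have e2 : 2 * ‖x‖ / t * (t - s) = 2 * ((1 - s / t) * ‖x‖) := by field_simp
  rw [e2]
  linarith

theorem tendsto_supportFlow_zero (hK : IsClosedConvexZero K) {x : H} (hx : x ∈ flowDomain K) :
    Tendsto (fun t => supportFlow K t x) (𝓝[≥] 0) (𝓝 x) := by
  rw [Metric.tendsto_nhds]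
  intro ε hε
  obtain ⟨y, ⟨f, hf⟩, hy⟩ := Metric.mem_closure_iff.1 hx (ε / 3) (by positivity)
  have hyD : y ∈ flowDomain K := subset_closure ⟨f, hf⟩
  have hlim : Tendsto (fun t : ℝ => t * ‖f‖) (𝓝[≥] 0) (𝓝 0) := by
    have : Continuous fun t : ℝ => t * ‖f‖ := by fun_prop
    simpa using (this.tendsto 0).mono_left nhdsWithin_le_nhds
  filter_upwards [hlim.eventually (gt_mem_nhds (show (0 : ℝ) < ε / 3 by positivity)),
    self_mem_nhdsWithin] with t h1 ht
  have ht : 0 ≤ t := ht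
  have h2 := norm_supportFlow_sub_le hK ht hx hyD
  have h3 : ‖supportFlow K t y - y‖ ≤ t * ‖f‖ :=
    le_of_tendsto ((tendsto_eulerScheme hK ht hyD).sub_const y).norm
      (eventually_nhdsWithin_of_forall fun _ hl => norm_eulerScheme_sub_self_le hK hl ht hf)
  rw [dist_eq_norm] at hy ⊢
  have e : supportFlow K t x - x = (supportFlow K t x - supportFlow K t y) +
      (supportFlow K t y - y) + -(x - y) := by abel
  rw [e]
  refine norm_add₃_le.trans_lt ?_
  rw [norm_neg]
  linarith

theorem continuousOn_supportFlow (hK : IsClosedConvexZero K) {x : H} (hx : x ∈ flowDomain K) :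
    ContinuousOn (fun t => supportFlow K t x) (Ici 0) := by
  intro t ht
  rcases (show (0 : ℝ) ≤ t from ht).eq_or_lt with rfl | ht
  · change Tendsto _ _ _
    simpa only [supportFlow_zero_left hK hx] using tendsto_supportFlow_zero hK hx
  · refine ContinuousAt.continuousWithinAt ?_
    have hM : 0 ≤ 2 * ‖x‖ / (t / 2) := by positivity
    have : LipschitzOnWith (2 * ‖x‖ / (t / 2)).toNNReal (fun t => supportFlow K t x) (Ioi (t / 2)) := by
      have key : ∀ r s : ℝ, t / 2 < r → r ≤ s → ‖supportFlow K s x - supportFlow K r x‖ ≤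
          2 * ‖x‖ / (t / 2) * (s - r) := fun r s hr hrs => by
        refine (norm_supportFlow_sub_supportFlow_le hK (by linarith) hrs hx).trans ?_
        have := sub_nonneg.2 hrs
        gcongr
        linarith
      refine LipschitzOnWith.of_dist_le_mul fun r hr s hs => ?_
      rw [dist_eq_norm, Real.dist_eq, Real.coe_toNNReal _ hM]
      rcases le_total r s with h | h
      · rw [norm_sub_rev, abs_sub_comm, abs_of_nonneg (sub_nonneg.2 h)]
        exact key r s hr h
      · rw [abs_of_nonneg (sub_nonneg.2 h)]
        exact key s r hs h
    exact this.continuousOn.continuousAt (Ioi_mem_nhds (by linarith))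

theorem tendsto_floor_div_mul {t : ℝ} (ht : 0 ≤ t) :
    Tendsto (fun l : ℝ => (⌊t / l⌋₊ : ℝ) * l) (𝓝[>] 0) (𝓝 t) := by
  have h : Tendsto (fun l : ℝ => t - l) (𝓝[>] 0) (𝓝 t) := by
    have : Continuous fun l : ℝ => t - l := by fun_prop
    simpa using (this.tendsto 0).mono_left nhdsWithin_le_nhds
  refine tendsto_of_tendsto_of_tendsto_of_le_of_le' h tendsto_const_nhds
    (eventually_nhdsWithin_of_forall fun l hl => ?_)
    (eventually_nhdsWithin_of_forall fun l hl => (floor_div_mul_mem hl ht).1)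
  linarith [(floor_div_mul_mem hl ht).2]

theorem tendsto_floor_sub_floor_mul {s t : ℝ} (hs : 0 ≤ s) (hst : s ≤ t) :
    Tendsto (fun l : ℝ => ((⌊t / l⌋₊ - ⌊s / l⌋₊ : ℕ) : ℝ) * l) (𝓝[>] 0) (𝓝 (t - s)) := by
  refine ((tendsto_floor_div_mul (hs.trans hst)).sub (tendsto_floor_div_mul hs)).congr'
    (eventually_nhdsWithin_of_forall fun l hl => ?_)
  simp only [Nat.cast_sub (Nat.floor_mono (div_le_div_of_nonneg_right hst (le_of_lt hl))), sub_mul]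

theorem inv_smul_supportFlow_sub_mem (hK : IsClosedConvexZero K) {s t : ℝ} (hs : 0 ≤ s)
    (hst : s < t) {x : H} (hx : x ∈ flowDomain K) :
    (t - s)⁻¹ • (supportFlow K s x - supportFlow K t x) ∈ K := by
  have hr := tendsto_floor_sub_floor_mul hs hst.le
  have h0 := sub_pos.2 hst
  refine hK.closed.mem_of_tendsto ((hr.inv₀ h0.ne').smul ((tendsto_eulerScheme hK hs hx).sub
    (tendsto_eulerScheme hK (hs.trans hst.le) hx))) ?_
  -- For small `l` at least one Euler step falls between `s` and `t`, so the elapsed discrete time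
  -- can be divided out.
  filter_upwards [hr.eventually (lt_mem_nhds h0), self_mem_nhdsWithin] with l h1 hl
  obtain ⟨g, hg, h⟩ := exists_iterate_prox_sub_eq_smul hK hl x ⌊s / l⌋₊ (⌊t / l⌋₊ - ⌊s / l⌋₊)
  rw [Nat.add_sub_cancel' (Nat.floor_mono (div_le_div_of_nonneg_right hst.le (le_of_lt hl)))] at h
  rwa [eulerScheme, eulerScheme, h, smul_smul, inv_mul_cancel₀ h1.ne', one_smul]

theorem norm_supportFlow_sq_sub_le (hK : IsClosedConvexZero K) {s t : ℝ} (hs : 0 ≤ s)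
    (hst : s ≤ t) {x : H} (hx : x ∈ flowDomain K) {f : H} (hf : f ∈ K) :
    ‖supportFlow K t x‖ ^ 2 / 2 - ‖supportFlow K s x‖ ^ 2 / 2 ≤
      -((t - s) * ⟪f, supportFlow K t x⟫_ℝ) := by
  have h1 := tendsto_eulerScheme hK hs hx
  have h2 := tendsto_eulerScheme hK (hs.trans hst) hx
  refine le_of_tendsto_of_tendsto (((h2.norm.pow 2).div_const 2).sub ((h1.norm.pow 2).div_const 2))
    ((tendsto_floor_sub_floor_mul hs hst).mul (tendsto_const_nhds.inner h2)).neg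
    (eventually_nhdsWithin_of_forall fun l hl => ?_)
  have h := norm_iterate_prox_sq_sub_le hK hl x ⌊s / l⌋₊ (⌊t / l⌋₊ - ⌊s / l⌋₊) f hf
  rwa [Nat.add_sub_cancel' (Nat.floor_mono (div_le_div_of_nonneg_right hst (le_of_lt hl)))] at h

end SupportFunctionFlow

/-! ### Weak derivatives of locally Lipschitz curves in a separable Hilbert space. -/

section WeakDerivative

open scoped InnerProductSpace

variable {H : Type*} [NormedAddCommGroup H] [InnerProductSpace ℝ H]

/-- Distinct basis vectors are at distance `√2`, so the balls of radius `1 / 2` around them are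
disjoint. -/
theorem HilbertBasis.countable_of_separableSpace [TopologicalSpace.SeparableSpace H] {ι : Type*}
    (b : HilbertBasis ι ℝ H) : Countable ι := by
  rw [← countable_univ_iff]
  have hd : (univ : Set ι).PairwiseDisjoint fun i => Metric.ball (b i) (1 / 2) := by
    intro i _ j _ hij
    refine Metric.ball_disjoint_ball ?_
    have h : ‖b i - b j‖ ^ 2 = 2 := by
      rw [norm_sub_sq_real, b.orthonormal.2 hij, b.orthonormal.1 i, b.orthonormal.1 j]
      norm_num
    rw [dist_eq_norm]
    nlinarith [norm_nonneg (b i - b j)]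
  exact hd.countable_of_isOpen (fun _ _ => Metric.isOpen_ball)
    fun i _ => ⟨b i, Metric.mem_ball_self (by norm_num)⟩

theorem tendsto_inner_of_dense_span {α : Type*} {l : Filter α} {q : α → H} {y : H} {C : ℝ}
    (hq : ∀ᶠ a in l, ‖q a‖ ≤ C) {S : Set H} (hS : Dense (Submodule.span ℝ S : Set H))
    (h : ∀ v ∈ S, Tendsto (fun a => ⟪v, q a⟫_ℝ) l (𝓝 ⟪v, y⟫_ℝ)) (v : H) :
    Tendsto (fun a => ⟪v, q a⟫_ℝ) l (𝓝 ⟪v, y⟫_ℝ) := by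
  have hspan : ∀ w ∈ Submodule.span ℝ S, Tendsto (fun a => ⟪w, q a⟫_ℝ) l (𝓝 ⟪w, y⟫_ℝ) := by
    intro w hw
    induction hw using Submodule.span_induction with
    | mem x hx => exact h x hx
    | zero => simpa using tendsto_const_nhds
    | add x z _ _ hx hz => simpa only [inner_add_left] using hx.add hz
    | smul c x _ hx => simpa only [inner_smul_left] using hx.const_mul _
  rw [Metric.tendsto_nhds]
  intro ε hε
  obtain ⟨w, hw, hvw⟩ := Metric.mem_closure_iff.1 (hS v) (ε / 2 / (|C| + ‖y‖ + 1))
    (by positivity)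
  filter_upwards [hq, (hspan w hw).eventually (Metric.ball_mem_nhds _ (half_pos hε))]
    with a ha1 ha2
  rw [dist_eq_norm, lt_div_iff₀ (by positivity)] at hvw
  have e : ⟪v, q a⟫_ℝ - ⟪v, y⟫_ℝ = ⟪v - w, q a⟫_ℝ - ⟪v - w, y⟫_ℝ + (⟪w, q a⟫_ℝ - ⟪w, y⟫_ℝ) := by
    simp only [inner_sub_left]; ring
  have h1 := abs_real_inner_le_norm (v - w) (q a)
  have h2 := abs_real_inner_le_norm (v - w) y
  have h3 : ‖v - w‖ * ‖q a‖ ≤ ‖v - w‖ * |C| :=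
    mul_le_mul_of_nonneg_left (ha1.trans (le_abs_self C)) (norm_nonneg _)
  rw [Real.dist_eq] at ha2 ⊢
  rw [e]
  refine (abs_add_le _ _).trans_lt ?_
  have h4 := abs_sub (⟪v - w, q a⟫_ℝ) (⟪v - w, y⟫_ℝ)
  have h5 := norm_nonneg (v - w)
  nlinarith

theorem norm_sub_le_of_lipschitz_pos {F : Type*} [NormedAddCommGroup F] {u : ℝ → F} {M : ℝ}
    (hu : ∀ s t, 0 < s → s ≤ t → ‖u t - u s‖ ≤ M / s * (t - s)) {a s t : ℝ}
    (ha : 0 < a)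
    (hM : 0 ≤ M) (hs : a ≤ s) (ht : a ≤ t) : ‖u t - u s‖ ≤ M / a * |t - s| := by
  have key : ∀ s t, a ≤ s → s ≤ t → ‖u t - u s‖ ≤ M / a * (t - s) := fun s t hs hst => by
    refine (hu s t (ha.trans_le hs) hst).trans ?_
    have := sub_nonneg.2 hst
    gcongr
  rcases le_total s t with h | h
  · rw [abs_of_nonneg (sub_nonneg.2 h)]
    exact key s t hs h
  · rw [norm_sub_rev, abs_sub_comm, abs_of_nonneg (sub_nonneg.2 h)]
    exact key t s ht h

variable {u : ℝ → H} {M : ℝ}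

theorem absolutelyContinuousOnInterval_inner_of_lipschitz_pos
    (hu : ∀ s t, 0 < s → s ≤ t → ‖u t - u s‖ ≤ M / s * (t - s)) (hM : 0 ≤ M) (v : H)
    {a c : ℝ} (ha : 0 < a) (hac : a ≤ c) :
    AbsolutelyContinuousOnInterval (fun r => ⟪v, u r⟫_ℝ) a c := by
  have hC : 0 ≤ ‖v‖ * (M / a) := by positivity
  refine LipschitzOnWith.absolutelyContinuousOnInterval (K := (‖v‖ * (M / a)).toNNReal) ?_
  rw [uIcc_of_le hac]
  refine LipschitzOnWith.of_dist_le_mul fun s hs t ht => ?_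
  rw [Real.coe_toNNReal _ hC, Real.dist_eq, Real.dist_eq, ← inner_sub_right, mul_assoc]
  exact (abs_real_inner_le_norm _ _).trans (mul_le_mul_of_nonneg_left
    (norm_sub_le_of_lipschitz_pos hu ha hM ht.1 hs.1) (norm_nonneg _))

theorem ae_differentiableAt_inner_of_lipschitz_pos
    (hu : ∀ s t, 0 < s → s ≤ t → ‖u t - u s‖ ≤ M / s * (t - s)) (hM : 0 ≤ M) (v : H) :
    ∀ᵐ t ∂(volume.restrict (Ioi (0 : ℝ))), DifferentiableAt ℝ (fun r => ⟪v, u r⟫_ℝ) t := by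
  rw [ae_restrict_iff' measurableSet_Ioi]
  have h : ∀ k : ℕ, ∀ᵐ t : ℝ, t ∈ uIcc (1 / ((k : ℝ) + 1)) (k + 1) →
      DifferentiableAt ℝ (fun r => ⟪v, u r⟫_ℝ) t := fun k => by
    refine (absolutelyContinuousOnInterval_inner_of_lipschitz_pos hu hM v (by positivity)
      ?_).ae_differentiableAt
    rw [div_le_iff₀ (by positivity)]
    nlinarith [(Nat.cast_nonneg k : (0 : ℝ) ≤ k)]
  filter_upwards [ae_all_iff.2 h] with t ht h0
  have h0 : 0 < t := h0
  obtain ⟨k, hk⟩ := exists_nat_ge (max t (1 / t))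
  refine ht k (mem_uIcc_of_le ?_ ?_)
  · have : 1 / t ≤ k + 1 := (le_max_right _ _).trans (hk.trans (by linarith))
    rwa [one_div_le (by positivity) h0]
  · exact (le_max_left _ _).trans (hk.trans (by linarith))

theorem slope_inner_right (v : H) (t : ℝ) :
    slope (fun r => ⟪v, u r⟫_ℝ) t = fun r => ⟪v, slope u t r⟫_ℝ := by
  funext r
  simp [slope_def_module, inner_smul_right, inner_sub_right]

theorem norm_slope_le {a t r : ℝ} (hM : 0 ≤ M)
    (hu : ∀ s t, 0 < s → s ≤ t → ‖u t - u s‖ ≤ M / s * (t - s)) (ha : 0 < a) (ht : a ≤ t)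
    (hr : a ≤ r) : ‖slope u t r‖ ≤ M / a := by
  rw [slope_def_module, norm_smul, norm_inv, Real.norm_eq_abs]
  rcases eq_or_ne r t with rfl | h
  · simp; positivity
  rw [inv_mul_le_iff₀ (abs_pos.2 (sub_ne_zero.2 h)), mul_comm]
  exact norm_sub_le_of_lipschitz_pos hu ha hM ht hr

/-- Bessel's inequality for the bounded difference quotients passes to the limit, so the coordinate
derivatives are square summable. Boundedness also upgrades coordinatewise convergence to weak
convergence. -/
theorem exists_weak_derivative [CompleteSpace H] {ι : Type*} (b : HilbertBasis ι ℝ H)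
    (hM : 0 ≤ M) (hu : ∀ s t, 0 < s → s ≤ t → ‖u t - u s‖ ≤ M / s * (t - s)) {t : ℝ}
    (ht : 0 < t) (hd : ∀ i, DifferentiableAt ℝ (fun r => ⟪b i, u r⟫_ℝ) t) :
    ∃ y : H, HasSum (fun i => deriv (fun r => ⟪b i, u r⟫_ℝ) t • b i) y ∧ ‖y‖ ≤ M / t ∧
      ∀ v, HasDerivAt (fun r => ⟪v, u r⟫_ℝ) ⟪v, y⟫_ℝ t := by
  set d : ι → ℝ := fun i => deriv (fun r => ⟪b i, u r⟫_ℝ) t with hd'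
  have hslope : ∀ i, Tendsto (fun r => ⟪b i, slope u t r⟫_ℝ) (𝓝[≠] t) (𝓝 (d i)) := fun i => by
    simpa only [← slope_inner_right] using (hd i).hasDerivAt.tendsto_slope
  have hsum : ∀ F : Finset ι, ∑ i ∈ F, ‖d i‖ ^ 2 ≤ (M / t) ^ 2 := fun F => by
    -- Only right difference quotients are used here: the Lipschitz constant is taken at the left
    -- endpoint, so these are bounded by exactly `M / t`.
    have h1 : Tendsto (fun r => ∑ i ∈ F, ‖⟪b i, slope u t r⟫_ℝ‖ ^ 2) (𝓝[>] t)
        (𝓝 (∑ i ∈ F, ‖d i‖ ^ 2)) := tendsto_finsetSum _ fun i _ =>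
      (((hslope i).mono_left (nhdsWithin_mono _ fun r hr => ne_of_gt hr)).norm.pow 2)
    refine le_of_tendsto h1 (eventually_nhdsWithin_of_forall fun r hr => ?_)
    exact (b.orthonormal.sum_inner_products_le _).trans
      (pow_le_pow_left₀ (norm_nonneg _) (norm_slope_le hM hu ht le_rfl (le_of_lt hr)) 2)
  have hmem : Memℓp d 2 := by
    refine memℓp_gen' (C := (M / t) ^ 2) fun F => ?_
    simpa using hsum F
  set f : lp (fun _ : ι => ℝ) 2 := ⟨d, hmem⟩ with hf
  refine ⟨b.repr.symm f, b.hasSum_repr_symm f, ?_, fun v => ?_⟩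
  · rw [LinearIsometryEquiv.norm_map]
    refine lp.norm_le_of_forall_sum_le (by norm_num) (by positivity) fun F => ?_
    simpa using hsum F
  · rw [hasDerivAt_iff_tendsto_slope]
    rw [slope_inner_right]
    -- For two-sided quotients it is enough to have some bound near `t`; `r > t / 2` gives one.
    refine tendsto_inner_of_dense_span (C := M / (t / 2)) (S := range b) ?_ ?_ ?_ v
    · filter_upwards [mem_nhdsWithin_of_mem_nhds (Ioi_mem_nhds (half_lt_self ht))] with r hr
      exact norm_slope_le hM hu (half_pos ht) (half_le_self ht.le) (le_of_lt hr)
    · have := b.dense_span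
      rwa [← Submodule.dense_iff_topologicalClosure_eq_top] at this
    · rintro _ ⟨i, rfl⟩
      have : ⟪b i, b.repr.symm f⟫_ℝ = d i := by
        rw [← b.repr_apply_apply, LinearIsometryEquiv.apply_symm_apply]
      rw [this]
      exact hslope i

/-- A function on `(0, ∞)` with values in a separable Hilbert space that is locally Lipschitz is
almost everywhere weakly differentiable and is the integral of its weak derivative. -/
theorem exists_ae_weak_derivative [CompleteSpace H] [TopologicalSpace.SeparableSpace H]
    (hM : 0 ≤ M) (hu : ∀ s t, 0 < s → s ≤ t → ‖u t - u s‖ ≤ M / s * (t - s)) :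
    ∃ ut : ℝ → H, AEStronglyMeasurable ut (volume.restrict (Ioi 0)) ∧
      (∀ᵐ t ∂(volume.restrict (Ioi (0 : ℝ))), ‖ut t‖ ≤ M / t ∧
        ∀ v, HasDerivAt (fun r => ⟪v, u r⟫_ℝ) ⟪v, ut t⟫_ℝ t) ∧
      ∀ a c, 0 < a → a ≤ c → u c - u a = ∫ r in a..c, ut r := by
  obtain ⟨w, b, -⟩ := exists_hilbertBasis ℝ H
  have : Countable w := b.countable_of_separableSpace
  have hae := (ae_all_iff.2 fun i =>
    ae_differentiableAt_inner_of_lipschitz_pos hu hM (b i)).and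
      (ae_restrict_mem (measurableSet_Ioi (a := (0 : ℝ))))
  set ut : ℝ → H := fun t => ∑' i, deriv (fun r => ⟪b i, u r⟫_ℝ) t • b i with hut
  have hmain : ∀ᵐ t ∂(volume.restrict (Ioi (0 : ℝ))),
      HasSum (fun i => deriv (fun r => ⟪b i, u r⟫_ℝ) t • b i) (ut t) ∧ ‖ut t‖ ≤ M / t ∧
        ∀ v, HasDerivAt (fun r => ⟪v, u r⟫_ℝ) ⟪v, ut t⟫_ℝ t := by
    filter_upwards [hae] with t ht
    obtain ⟨y, h1, h2⟩ := exists_weak_derivative b hM hu ht.2 ht.1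
    have : ut t = y := h1.tsum_eq
    rw [this]
    exact ⟨h1, h2⟩
  have hmeas : AEStronglyMeasurable ut (volume.restrict (Ioi 0)) := by
    -- Countability of the basis makes `atTop` on its finite subsets countably generated.
    refine aestronglyMeasurable_of_tendsto_ae (u := atTop (α := Finset w))
      (f := fun F t => ∑ i ∈ F, deriv (fun r => ⟪b i, u r⟫_ℝ) t • b i) (fun F => ?_)
      (hmain.mono fun t ht => ht.1)
    refine Finset.aestronglyMeasurable_fun_sum _ fun i _ => ?_
    exact ((measurable_deriv _).stronglyMeasurable.smul_const _).aestronglyMeasurable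
  refine ⟨ut, hmeas, hmain.mono fun t ht => ht.2, fun a c ha hac => ?_⟩
  have hsub : Ioc a c ⊆ Ioi 0 := fun r hr => ha.trans hr.1
  have hmain' := ae_restrict_of_ae_restrict_of_subset hsub hmain
  have hint : IntervalIntegrable ut volume a c := by
    rw [intervalIntegrable_iff_integrableOn_Ioc_of_le hac]
    refine ⟨hmeas.mono_set hsub, HasFiniteIntegral.restrict_of_bounded (C := M / a) (by simp) ?_⟩
    filter_upwards [hmain', ae_restrict_mem measurableSet_Ioc] with r hr hr2
    exact hr.2.1.trans (div_le_div_of_nonneg_left hM ha hr2.1.le)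
  -- Pairing with `v` reduces the claim to the fundamental theorem of calculus for absolutely
  -- continuous real functions.
  refine ext_inner_left ℝ fun v => ?_
  have h1 := (innerSL ℝ v).intervalIntegral_comp_comm hint
  simp only [innerSL_apply_apply] at h1
  rw [← h1, inner_sub_right, ← (absolutelyContinuousOnInterval_inner_of_lipschitz_pos hu hM v ha
    hac).integral_deriv_eq_sub]
  refine intervalIntegral.integral_congr_ae ?_
  rw [uIoc_of_le hac, ← ae_restrict_iff' measurableSet_Ioc]
  filter_upwards [hmain'] with r hr
  exact (hr.2.2 v).deriv

end WeakDerivative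

/-! ### Uniqueness and identification of the limit flow as the gradient flow. -/

section GradientFlowTheory

open scoped InnerProductSpace

variable {H : Type*} [NormedAddCommGroup H] [InnerProductSpace ℝ H]

theorem subdifferential_monotone {E : H → EReal} (hE : ∀ v, 0 ≤ E v) {f g v w : H}
    (hf : f ∈ subdifferential E v) (hg : g ∈ subdifferential E w) : 0 ≤ ⟪v - w, f - g⟫_ℝ := by
  have h1 := hf.2 (w - v)
  have h2 := hg.2 (v - w)
  rw [add_sub_cancel] at h1 h2
  have hv : E v ≠ ⊥ := ne_of_gt (EReal.bot_lt_zero.trans_le (hE v))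
  have hw : E w ≠ ⊥ := ne_of_gt (EReal.bot_lt_zero.trans_le (hE w))
  have e1 := EReal.coe_toReal (ne_of_lt hf.1) hv
  have e2 := EReal.coe_toReal (ne_of_lt hg.1) hw
  rw [← e1, ← e2] at h1 h2
  norm_cast at h1 h2
  rw [inner_sub_right]
  rw [← neg_sub v w, inner_neg_left] at h1
  linarith

/-- If `R` bounds the curve, increments of its squared norm are at most `2 * R` times increments of
`∫ ‖f‖`, which is absolutely continuous. -/
theorem absolutelyContinuousOnInterval_norm_sq_integral {f : ℝ → H} {a c : ℝ} (hac : a ≤ c)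
    (hf : IntervalIntegrable f volume a c) (z : H) :
    AbsolutelyContinuousOnInterval (fun r => ‖z + ∫ x in a..r, f x‖ ^ 2) a c := by
  set w : ℝ → H := fun r => z + ∫ x in a..r, f x with hw
  set G : ℝ → ℝ := fun r => ∫ x in a..r, ‖f x‖ with hG
  have hint : ∀ r ∈ Icc a c, ∀ s ∈ Icc a c, IntervalIntegrable f volume r s := by
    intro r hr s hs
    exact hf.mono_set (by rw [uIcc_of_le hac]; exact uIcc_subset_Icc hr hs)
  have ha : a ∈ Icc a c := left_mem_Icc.2 hac
  have hdiff : ∀ r ∈ Icc a c, ∀ s ∈ Icc a c, ‖w s - w r‖ ≤ |G s - G r| := by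
    intro r hr s hs
    have e1 : w s - w r = ∫ x in r..s, f x := by
      simp only [hw, add_sub_add_left_eq_sub]
      exact intervalIntegral.integral_interval_sub_left (hint a ha s hs) (hint a ha r hr)
    have e2 : G s - G r = ∫ x in r..s, ‖f x‖ :=
      intervalIntegral.integral_interval_sub_left (hint a ha s hs).norm (hint a ha r hr).norm
    rw [e1, e2]
    exact intervalIntegral.norm_integral_le_abs_integral_norm
  obtain ⟨R, hR⟩ : ∃ R, ∀ r ∈ Icc a c, ‖w r‖ ≤ R := by
    have hc : ContinuousOn w (Icc a c) := by
      refine continuousOn_const.add ?_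
      rw [← uIcc_of_le hac]
      exact intervalIntegral.continuousOn_primitive_interval'
        hf (by rw [uIcc_of_le hac]; exact ha)
    exact isCompact_Icc.exists_bound_of_continuousOn hc
  have hGac : AbsolutelyContinuousOnInterval G a c :=
    hf.norm.absolutelyContinuousOnInterval_intervalIntegral left_mem_uIcc
  have hlim := (hGac.const_mul (2 * R))
  refine squeeze_zero' (Eventually.of_forall fun _ => Finset.sum_nonneg fun _ _ => dist_nonneg) ?_
    hlim
  filter_upwards [mem_inf_of_right (mem_principal_self _)] with I hI
  refine Finset.sum_le_sum fun i hi => ?_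
  obtain ⟨h1, h2⟩ := hI.1 i hi
  rw [uIcc_of_le hac] at h1 h2
  have hR0 : 0 ≤ R := (norm_nonneg _).trans (hR a ha)
  rw [Real.dist_eq, Real.dist_eq, ← mul_sub, abs_mul, abs_of_nonneg (by positivity : 0 ≤ 2 * R)]
  have h3 := hdiff _ h2 _ h1
  have h4 := abs_norm_sub_norm_le (w (I.2 i).1) (w (I.2 i).2)
  have e : ‖w (I.2 i).1‖ ^ 2 - ‖w (I.2 i).2‖ ^ 2 = (‖w (I.2 i).1‖ + ‖w (I.2 i).2‖) *
      (‖w (I.2 i).1‖ - ‖w (I.2 i).2‖) := by ring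
  change |‖w (I.2 i).1‖ ^ 2 - ‖w (I.2 i).2‖ ^ 2| ≤ _
  rw [e, abs_mul, abs_of_nonneg (by positivity)]
  refine mul_le_mul ?_ (h4.trans h3) (abs_nonneg _) (by positivity)
  linarith [hR _ h1, hR _ h2]

theorem norm_le_of_ae_inner_nonpos [CompleteSpace H] {w f : ℝ → H} {a c : ℝ} (hac : a ≤ c)
    (hf : IntervalIntegrable f volume a c) (hw : ∀ r ∈ Icc a c, w r = w a + ∫ x in a..r, f x)
    (h : ∀ᵐ r, r ∈ Icc a c → ⟪w r, f r⟫_ℝ ≤ 0) : ‖w c‖ ≤ ‖w a‖ := by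
  have hac' := absolutelyContinuousOnInterval_norm_sq_integral hac hf (w a)
  have h1 := hac'.integral_deriv_eq_sub
  have h2 : ∫ r in a..c, deriv (fun r => ‖w a + ∫ x in a..r, f x‖ ^ 2) r ≤ 0 := by
    rw [intervalIntegral.integral_of_le hac]
    refine integral_nonpos_of_ae ?_
    rw [EventuallyLE, ae_restrict_iff' measurableSet_Ioc]
    filter_upwards [h, hf.ae_hasDerivAt_integral] with r hr hr2 hr3
    have hr4 := Ioc_subset_Icc_self hr3
    have hd := (hr2 (by rwa [uIcc_of_le hac]) a left_mem_uIcc).const_add (w a)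
    have hd2 := hd.norm_sq
    rw [hd2.deriv, ← hw r hr4]
    have := hr hr4
    simp only [Pi.zero_apply]
    linarith
  rw [h1, ← hw c (right_mem_Icc.2 hac), intervalIntegral.integral_same, add_zero] at h2
  exact le_of_sq_le_sq (by linarith) (norm_nonneg _)

/-- By monotonicity `‖u - v‖` is nonincreasing on `(0, ∞)`. Integrability of the velocities is known
only away from `0`, so the comparison starts at `τ > 0` and continuity lets `τ → 0`. -/
theorem IsGradientFlow.unique [CompleteSpace H] {E : H → EReal} (hE : ∀ v, 0 ≤ E v) {u₀ : H}
    {u v : C(ℝ≥0, H)} (hu : IsGradientFlow E u₀ u) (hv : IsGradientFlow E u₀ v) : u = v := by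
  obtain ⟨hu0, ut, hu1, hu2, hu3⟩ := hu
  obtain ⟨hv0, vt, hv1, hv2, hv3⟩ := hv
  have hint : ∀ {f : ℝ → H}, (∀ δ : ℝ, 0 < δ → MemLp f 2 (volume.restrict (Ioi δ))) →
      ∀ a c : ℝ, 0 < a → a ≤ c → IntervalIntegrable f volume a c := by
    intro f hf a c ha hac
    rw [intervalIntegrable_iff_integrableOn_Ioc_of_le hac]
    have h1 := (hf (a / 2) (half_pos ha)).mono_measure (Measure.restrict_mono (s := Ioc a c)
      (fun r hr => (half_lt_self ha).trans hr.1) le_rfl)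
    exact h1.integrable (by norm_num)
  have key : ∀ τ t : ℝ≥0, 0 < τ → τ ≤ t → ‖u t - v t‖ ≤ ‖u τ - v τ‖ := by
    intro τ t hτ hτt
    have hτt' : (τ : ℝ) ≤ t := by exact_mod_cast hτt
    have hτ' : (0 : ℝ) < τ := by exact_mod_cast hτ
    have := norm_le_of_ae_inner_nonpos (w := fun r => u r.toNNReal - v r.toNNReal)
      (f := fun r => ut r - vt r) hτt'
      ((hint hu1 τ t hτ' hτt').sub (hint hv1 τ t hτ' hτt')) ?_ ?_
    · simpa only [Real.toNNReal_coe] using this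
    · intro r hr
      have hr0 : 0 ≤ r := hτ'.le.trans hr.1
      lift r to ℝ≥0 using hr0
      have hr1 : τ ≤ r := by exact_mod_cast hr.1
      simp only [Real.toNNReal_coe]
      rw [intervalIntegral.integral_sub (hint hu1 τ r hτ' hr.1) (hint hv1 τ r hτ' hr.1),
        ← hu2 τ r hτ hr1, ← hv2 τ r hτ hr1]
      abel
    · rw [ae_restrict_iff' measurableSet_Ioi] at hu3 hv3
      filter_upwards [hu3, hv3] with r h1 h2 hr
      have hr0 : r ∈ Ioi (0 : ℝ) := hτ'.trans_le hr.1
      have := subdifferential_monotone hE (h1 hr0) (h2 hr0)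
      rw [← neg_sub', inner_neg_right] at this
      linarith
  ext1 t
  rcases eq_or_lt_of_le (zero_le (a := t)) with rfl | ht
  · rw [hu0, hv0]
  have hlim : Tendsto (fun τ : ℝ≥0 => ‖u τ - v τ‖) (𝓝[>] 0) (𝓝 0) := by
    have : Continuous fun τ : ℝ≥0 => ‖u τ - v τ‖ := by fun_prop
    simpa [hu0, hv0] using (this.tendsto 0).mono_left nhdsWithin_le_nhds
  refine sub_eq_zero.1 (norm_le_zero_iff.1 (ge_of_tendsto hlim ?_))
  filter_upwards [Ioo_mem_nhdsGT ht] with τ hτ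
  exact key τ t hτ.1 hτ.2.le

/-- A closed convex set is weakly closed: test with `y - p`, where `p` is the projection of `y` onto
`K`. -/
theorem IsClosedConvexZero.mem_of_tendsto_inner [CompleteSpace H] {K : Set H}
    (hK : IsClosedConvexZero K) {α : Type*} {l : Filter α} [l.NeBot] {g : α → H} {y : H}
    (hg : ∀ᶠ a in l, g a ∈ K) (h : ∀ v, Tendsto (fun a => ⟪v, g a⟫_ℝ) l (𝓝 ⟪v, y⟫_ℝ)) :
    y ∈ K := by
  obtain ⟨p, hp, hmin⟩ := exists_norm_eq_iInf_of_complete_convex ⟨0, hK.zero_mem⟩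
    hK.closed.isComplete hK.convex y
  rw [norm_eq_iInf_iff_real_inner_le_zero hK.convex hp] at hmin
  have h1 : ⟪y - p, y⟫_ℝ ≤ ⟪y - p, p⟫_ℝ := by
    refine le_of_tendsto (h (y - p)) (hg.mono fun a ha => ?_)
    have := hmin _ ha
    rw [inner_sub_right] at this
    linarith
  have h2 : ⟪y - p, y - p⟫_ℝ ≤ 0 := by rw [inner_sub_right]; linarith
  rw [real_inner_self_nonpos, sub_eq_zero] at h2
  rwa [h2]

theorem supports_neg_weak_derivative [CompleteSpace H] {K : Set H} (hK : IsClosedConvexZero K)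
    {x : H} (hx : x ∈ flowDomain K) {t : ℝ} (ht : 0 < t) {y : H}
    (hy : ∀ v, HasDerivAt (fun r => ⟪v, supportFlow K r x⟫_ℝ) ⟪v, y⟫_ℝ t) :
    Supports K (-y) (supportFlow K t x) := by
  set u : ℝ → H := fun r => supportFlow K r x with hu
  have hslope : ∀ v, Tendsto (fun r => ⟪v, slope u t r⟫_ℝ) (𝓝[≠] t) (𝓝 ⟪v, y⟫_ℝ) := fun v => by
    simpa only [← slope_inner_right] using (hy v).tendsto_slope
  constructor
  · refine hK.mem_of_tendsto_inner (l := 𝓝[>] t) (g := fun r => -slope u t r)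
      (eventually_nhdsWithin_of_forall fun r hr => ?_) fun v => ?_
    · rw [slope_def_module, ← smul_neg, neg_sub]
      exact inv_smul_supportFlow_sub_mem hK ht.le hr hx
    · simp only [inner_neg_right]
      exact ((hslope v).mono_left (nhdsWithin_mono _ fun r hr => ne_of_gt hr)).neg
  · intro f hf
    -- Left quotients are taken because the energy inequality on `[r, t]` pairs `f` with the value
    -- at the later time `t`, which stays fixed as `r → t`. The Lipschitz bound leaves a remainder
    -- `C ^ 2 / 2 * (t - r)`.
    have h1 : Tendsto (fun r => ⟪u t, slope u t r⟫_ℝ) (𝓝[<] t) (𝓝 ⟪u t, y⟫_ℝ) :=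
      (hslope (u t)).mono_left (nhdsWithin_mono _ fun r hr => ne_of_lt hr)
    set C : ℝ := 2 * ‖x‖ / t with hC
    have h2 : Tendsto (fun r => -⟪f, u t⟫_ℝ + C ^ 2 / 2 * (t - r)) (𝓝[<] t)
        (𝓝 (-⟪f, u t⟫_ℝ)) := by
      have : Continuous fun r => -⟪f, u t⟫_ℝ + C ^ 2 / 2 * (t - r) := by fun_prop
      simpa using (this.tendsto t).mono_left nhdsWithin_le_nhds
    have h3 : ⟪u t, y⟫_ℝ ≤ -⟪f, u t⟫_ℝ := by
      refine le_of_tendsto_of_tendsto h1 h2 ?_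
      filter_upwards [Ioo_mem_nhdsLT ht] with r hr
      have hr' : 0 < t - r := sub_pos.2 hr.2
      have h4 := norm_supportFlow_sq_sub_le hK hr.1.le hr.2.le hx hf
      have h5 : ‖u t - u r‖ ≤ C * (t - r) :=
        norm_supportFlow_sub_supportFlow_le hK hr.1 hr.2.le hx
      have h6 := pow_le_pow_left₀ (norm_nonneg _) h5 2
      have h7 : ‖u r‖ ^ 2 = ‖u t‖ ^ 2 - 2 * ⟪u t, u t - u r⟫_ℝ + ‖u t - u r‖ ^ 2 := by
        rw [← norm_sub_sq_real, sub_sub_cancel]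
      have h8 : slope u t r = (t - r)⁻¹ • (u t - u r) := by
        rw [slope_def_module, ← neg_sub t r, inv_neg, neg_smul, ← smul_neg, neg_sub]
      rw [h8, inner_smul_right, inv_mul_le_iff₀ hr']
      change ‖u t‖ ^ 2 / 2 - ‖u r‖ ^ 2 / 2 ≤ -((t - r) * ⟪f, u t⟫_ℝ) at h4
      nlinarith
    rw [inner_neg_left, real_inner_comm _ y]
    exact le_neg_of_le_neg h3

theorem memLp_two_of_norm_le_div {F : Type*} [NormedAddCommGroup F] {f : ℝ → F} {M δ : ℝ}
    (hδ : 0 < δ)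
    (hf : AEStronglyMeasurable f (volume.restrict (Ioi 0)))
    (h : ∀ᵐ t ∂(volume.restrict (Ioi (0 : ℝ))), ‖f t‖ ≤ M / t) :
    MemLp f 2 (volume.restrict (Ioi δ)) := by
  have hsub : Ioi δ ⊆ Ioi (0 : ℝ) := Ioi_subset_Ioi hδ.le
  have hg : MemLp (fun t : ℝ => M / t) 2 (volume.restrict (Ioi δ)) := by
    rw [memLp_two_iff_integrable_sq (by fun_prop)]
    have := (integrableOn_Ioi_rpow_of_lt (show (-2 : ℝ) < -1 by norm_num) hδ).const_mul (M ^ 2)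
    refine IntegrableOn.congr_fun this (fun t ht => ?_) measurableSet_Ioi
    have ht : 0 < t := hδ.trans ht
    simp only [Real.rpow_neg ht.le, Real.rpow_two]
    field_simp
  refine hg.mono (hf.mono_set hsub) ?_
  filter_upwards [ae_restrict_of_ae_restrict_of_subset hsub h] with t ht
  exact ht.trans (le_abs_self _)

variable {E : H → EReal} {K₀ : Set H}

theorem isClosedConvexZero_closedConvexHull (h0 : (0 : H) ∈ K₀) :
    IsClosedConvexZero (closedConvexHull ℝ K₀) :=
  ⟨convex_closedConvexHull, isClosed_closedConvexHull, subset_closedConvexHull h0⟩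

theorem supportFunction_nonneg (h0 : (0 : H) ∈ K₀)
    (hE : ∀ v, E v = ⨆ f ∈ K₀, ((⟪f, v⟫_ℝ : ℝ) : EReal)) (v : H) : 0 ≤ E v := by
  rw [hE]
  refine le_iSup₂_of_le 0 h0 ?_
  simp

/-- The half-space `⟪·, v⟫ ≤ E v` is closed and convex, so passing to the closed convex hull does
not change the support function. -/
theorem coe_inner_le_of_mem_closedConvexHull (h0 : (0 : H) ∈ K₀)
    (hE : ∀ v, E v = ⨆ f ∈ K₀, ((⟪f, v⟫_ℝ : ℝ) : EReal)) {f : H}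
    (hf : f ∈ closedConvexHull ℝ K₀) (v : H) : ((⟪f, v⟫_ℝ : ℝ) : EReal) ≤ E v := by
  by_cases htop : E v = ⊤
  · rw [htop]; exact le_top
  have hbot : E v ≠ ⊥ := ne_of_gt (EReal.bot_lt_zero.trans_le (supportFunction_nonneg h0 hE v))
  have e := EReal.coe_toReal htop hbot
  have hsub : closedConvexHull ℝ K₀ ⊆ {g : H | ⟪g, v⟫_ℝ ≤ (E v).toReal} := by
    refine closedConvexHull_min (fun g hg => ?_) ?_ ?_
    · have : ((⟪g, v⟫_ℝ : ℝ) : EReal) ≤ E v := by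
        rw [hE]; exact le_iSup₂_of_le g hg le_rfl
      rw [← e] at this
      exact_mod_cast this
    · exact convex_halfSpace_le ⟨fun x y => inner_add_left _ _ _,
        fun c x => by simp [inner_smul_left]⟩ _
    · exact isClosed_le (by fun_prop) continuous_const
  rw [← e]
  exact_mod_cast hsub hf

theorem Supports.eq_supportFunction (h0 : (0 : H) ∈ K₀)
    (hE : ∀ v, E v = ⨆ f ∈ K₀, ((⟪f, v⟫_ℝ : ℝ) : EReal)) {f v : H}
    (hf : Supports (closedConvexHull ℝ K₀) f v) : E v = ((⟪f, v⟫_ℝ : ℝ) : EReal) := by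
  refine le_antisymm ?_ (coe_inner_le_of_mem_closedConvexHull h0 hE hf.1 v)
  rw [hE]
  exact iSup₂_le fun g hg => by exact_mod_cast hf.2 g (subset_closedConvexHull hg)

theorem Supports.mem_subdifferential (h0 : (0 : H) ∈ K₀)
    (hE : ∀ v, E v = ⨆ f ∈ K₀, ((⟪f, v⟫_ℝ : ℝ) : EReal)) {f v : H}
    (hf : Supports (closedConvexHull ℝ K₀) f v) : f ∈ subdifferential E v := by
  have e := hf.eq_supportFunction h0 hE
  refine ⟨?_, fun h => ?_⟩
  · change E v < ⊤
    rw [e]; exact EReal.coe_lt_top _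
  · rw [e, real_inner_comm f h, ← EReal.coe_add, ← inner_add_right]
    exact coe_inner_le_of_mem_closedConvexHull h0 hE hf.1 _

/-- With `x - prox K l x = l • f`, one has `l‖f‖² ≤ ⟪f, x⟫ ≤ E x`, hence `‖x - prox K l x‖² ≤ l * E
x → 0`; the points `prox K l x` carry subgradients. -/
theorem effectiveDomain_subset_flowDomain [CompleteSpace H] (h0 : (0 : H) ∈ K₀)
    (hE : ∀ v, E v = ⨆ f ∈ K₀, ((⟪f, v⟫_ℝ : ℝ) : EReal)) :
    effectiveDomain E ⊆ flowDomain (closedConvexHull ℝ K₀) := by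
  intro x hx
  have hK := isClosedConvexZero_closedConvexHull h0
  have hbot : E x ≠ ⊥ := ne_of_gt (EReal.bot_lt_zero.trans_le (supportFunction_nonneg h0 hE x))
  have e := EReal.coe_toReal (ne_of_lt hx) hbot
  set K := closedConvexHull ℝ K₀
  have hbound : ∀ l : ℝ, 0 < l → ‖x - prox K l x‖ ^ 2 ≤ l * (E x).toReal := by
    intro l hl
    have h1 := supports_prox hK hl x
    have h2 := prox_add_smul_inv (K := K) hl x
    set f := l⁻¹ • (x - prox K l x) with hf
    have h3 : x - prox K l x = l • f := by
      rw [hf, smul_smul, mul_inv_cancel₀ hl.ne', one_smul]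
    have h4 := coe_inner_le_of_mem_closedConvexHull h0 hE h1.1 x
    rw [← e] at h4
    have h4 : ⟪f, x⟫_ℝ ≤ (E x).toReal := by exact_mod_cast h4
    have h5 := h1.inner_nonneg hK
    have h6 : ⟪f, x⟫_ℝ = ⟪f, prox K l x⟫_ℝ + l * ‖f‖ ^ 2 := by
      rw [← real_inner_self_eq_norm_sq, ← inner_smul_right, ← inner_add_right, h2]
    rw [h3, norm_smul, mul_pow, Real.norm_of_nonneg hl.le]
    nlinarith
  refine mem_closure_of_tendsto (f := fun l => prox K l x) (b := 𝓝[>] (0 : ℝ)) ?_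
    (eventually_nhdsWithin_of_forall fun l hl => ⟨_, supports_prox hK hl x⟩)
  rw [tendsto_iff_norm_sub_tendsto_zero]
  have hlim : Tendsto (fun l : ℝ => √(l * (E x).toReal)) (𝓝[>] 0) (𝓝 0) := by
    have : Continuous fun l : ℝ => √(l * (E x).toReal) := by fun_prop
    simpa using (this.tendsto 0).mono_left nhdsWithin_le_nhds
  refine squeeze_zero' (Eventually.of_forall fun _ => norm_nonneg _)
    (eventually_nhdsWithin_of_forall fun l hl => ?_) hlim
  rw [norm_sub_rev]
  exact Real.le_sqrt_of_sq_le (hbound l hl)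

/-- Existence and uniqueness for the gradient flow of the support function of a set containing the
origin. -/
theorem existsUnique_isGradientFlow [CompleteSpace H] [TopologicalSpace.SeparableSpace H] (h0 : (0 : H) ∈ K₀)
    (hE : ∀ v, E v = ⨆ f ∈ K₀, ((⟪f, v⟫_ℝ : ℝ) : EReal)) {u₀ : H}
    (hu₀ : u₀ ∈ closure (effectiveDomain E)) : ∃! u : C(ℝ≥0, H), IsGradientFlow E u₀ u := by
  have hK := isClosedConvexZero_closedConvexHull h0
  have hx : u₀ ∈ flowDomain (closedConvexHull ℝ K₀) :=
    closure_minimal (effectiveDomain_subset_flowDomain h0 hE) isClosed_closure hu₀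
  set K := closedConvexHull ℝ K₀
  obtain ⟨ut, hm, hae, hint⟩ := exists_ae_weak_derivative (u := fun t => supportFlow K t u₀)
    (M := 2 * ‖u₀‖) (by positivity) fun s t hs hst => by
      -- The factor `1 / t` is weakened to `1 / s` to fit the hypothesis on locally Lipschitz
      -- curves.
      refine (norm_supportFlow_sub_supportFlow_le hK hs hst hx).trans ?_
      have := sub_nonneg.2 hst
      gcongr
  refine existsUnique_of_exists_of_unique ⟨⟨fun t => supportFlow K t u₀, ?_⟩, ?_, ut, ?_, ?_, ?_⟩
    fun u v hu hv => hu.unique (supportFunction_nonneg h0 hE) hv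
  · exact (continuousOn_supportFlow hK hx).comp_continuous NNReal.continuous_coe fun t => t.2
  · exact supportFlow_zero_left hK hx
  · exact fun δ hδ => memLp_two_of_norm_le_div hδ hm (hae.mono fun t ht => ht.1)
  · exact fun τ t hτ hτt => hint τ t (by exact_mod_cast hτ) (by exact_mod_cast hτt)
  · filter_upwards [hae, ae_restrict_mem measurableSet_Ioi] with t ht ht0
    have ht0 : 0 < t := ht0
    have := (supports_neg_weak_derivative hK hx ht0 ht.2).mem_subdifferential h0 hE
    simpa only [ContinuousMap.coe_mk, Real.coe_toNNReal t ht0.le] using this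

end GradientFlowTheory

/-! ### Fourier coefficients of smooth functions on the torus. -/

section TorusFourier

open UnitAddTorus

variable {n : ℕ}

theorem isProbabilityMeasure_volume_unitAddTorus (n : ℕ) :
    IsProbabilityMeasure (volume : Measure (UnitAddTorus (Fin n))) := by
  have : IsProbabilityMeasure (volume : Measure UnitAddCircle) := by
    rw [AddCircle.volume_eq_smul_haarAddCircle, ENNReal.ofReal_one, one_smul]
    infer_instance
  rw [volume_pi]
  infer_instance

attribute [local instance] isProbabilityMeasure_volume_unitAddTorus

theorem mFourierCoeff_eq_integral_mul (f : UnitAddTorus (Fin n) → ℂ) (m : Fin n → ℤ) :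
    mFourierCoeff f m = ∫ x, mFourier (-m) x * f x := by
  have h : (Measure.pi fun _ : Fin n => (AddCircle.haarAddCircle : Measure UnitAddCircle)) =
      volume := by
    rw [volume_pi]
    congr 1
    funext i
    rw [AddCircle.volume_eq_smul_haarAddCircle, ENNReal.ofReal_one, one_smul]
  rw [← h]
  rfl

theorem isOpenQuotientMap_torusCover (n : ℕ) : IsOpenQuotientMap (torusCover n) :=
  IsOpenQuotientMap.piMap fun _ : Fin n => QuotientAddGroup.isOpenQuotientMap_mk

theorem contDiff_smoothTorus (φ : SmoothTorus n) :
    ContDiff ℝ ∞ (fun x => φ.1 (torusCover n x)) :=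
  φ.2

theorem continuous_smoothTorus (φ : SmoothTorus n) : Continuous φ.1 :=
  (isOpenQuotientMap_torusCover n).isQuotientMap.continuous_iff.2 (contDiff_smoothTorus φ).continuous

theorem integrable_mul_smoothTorus (φ : SmoothTorus n) {g : UnitAddTorus (Fin n) → ℂ}
    (hg : Continuous g) : Integrable fun x => g x * (φ.1 x : ℂ) := by
  have h : Continuous fun x => g x * (φ.1 x : ℂ) :=
    hg.mul (Complex.continuous_ofReal.comp (continuous_smoothTorus φ))
  exact (BoundedContinuousFunction.mkOfCompact ⟨_, h⟩).integrable volume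

theorem norm_mFourier_apply (m : Fin n → ℤ) (x : UnitAddTorus (Fin n)) : ‖mFourier m x‖ = 1 := by
  simp only [mFourier, fourier_apply, ContinuousMap.coe_mk, norm_prod, Circle.norm_coe,
    Finset.prod_const_one]

theorem mFourier_add_apply (m : Fin n → ℤ) (x y : UnitAddTorus (Fin n)) :
    mFourier m (x + y) = mFourier m x * mFourier m y := by
  simp [mFourier, AddCircle.toCircle_add, Finset.prod_mul_distrib]

theorem mFourier_torusCover_single (m : Fin n → ℤ) (i : Fin n) (h : ℝ) :
    mFourier m (torusCover n (Pi.single i h)) =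
      Complex.exp (2 * Real.pi * Complex.I * m i * h) := by
  have e : mFourier m (torusCover n (Pi.single i h)) =
      ∏ j, Complex.exp (2 * Real.pi * Complex.I * m j * ((Pi.single i h : Fin n → ℝ) j : ℂ)) := by
    simp [mFourier, torusCover]
  rw [e, Finset.prod_eq_single i]
  · simp
  · intro j _ hj
    simp [Pi.single_eq_of_ne hj]
  · simp

/-- The Fourier coefficient of a smooth function. -/
def smoothCoeff (m : Fin n → ℤ) : SmoothTorus n →ₗ[ℝ] ℂ where
  toFun φ := mFourierCoeff (fun x => (φ.1 x : ℂ)) m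
  map_add' φ ψ := by
    simp only [mFourierCoeff_eq_integral_mul]
    rw [← integral_add (integrable_mul_smoothTorus φ (map_continuous _)) (integrable_mul_smoothTorus ψ (map_continuous _))]
    refine integral_congr_ae (Eventually.of_forall fun x => ?_)
    simp [mul_add]
  map_smul' c φ := by
    simp only [mFourierCoeff_eq_integral_mul, RingHom.id_apply]
    rw [← integral_smul]
    refine integral_congr_ae (Eventually.of_forall fun x => ?_)
    simp [mul_left_comm]

theorem smoothCoeff_eq (m : Fin n → ℤ) (φ : SmoothTorus n) :
    smoothCoeff m φ = ∫ x, mFourier (-m) x * (φ.1 x : ℂ) :=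
  mFourierCoeff_eq_integral_mul _ _

theorem conj_smoothCoeff (m : Fin n → ℤ) (φ : SmoothTorus n) :
    (starRingEnd ℂ) (smoothCoeff m φ) = smoothCoeff (-m) φ := by
  rw [smoothCoeff_eq, smoothCoeff_eq, ← integral_conj]
  refine integral_congr_ae (Eventually.of_forall fun x => ?_)
  simp [mFourier_neg]

theorem norm_smoothCoeff_le_integral (m : Fin n → ℤ) (φ : SmoothTorus n) :
    ‖smoothCoeff m φ‖ ≤ ∫ x, |φ.1 x| := by
  rw [smoothCoeff_eq]
  refine (norm_integral_le_integral_norm _).trans (le_of_eq ?_)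
  simp [norm_mFourier_apply]

theorem norm_smoothCoeff_le (m : Fin n → ℤ) (φ : SmoothTorus n) {M : ℝ}
    (h : ∀ x, |φ.1 x| ≤ M) : ‖smoothCoeff m φ‖ ≤ M := by
  refine (norm_smoothCoeff_le_integral m φ).trans ?_
  have h1 : Integrable fun x => |φ.1 x| :=
    (BoundedContinuousFunction.mkOfCompact ⟨_, (continuous_smoothTorus φ).abs⟩).integrable volume
  have := integral_mono h1 (integrable_const M) h
  simpa using this

theorem hasDerivAt_torusPartial (i : Fin n) (φ : SmoothTorus n) (x : UnitAddTorus (Fin n))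
    (h : ℝ) : HasDerivAt (fun r : ℝ => φ.1 (x + torusCover n (Pi.single i r)))
      (torusPartial i φ.1 (x + torusCover n (Pi.single i h))) h := by
  have h0 : ∀ y, HasDerivAt (fun r : ℝ => φ.1 (y + torusCover n (Pi.single i r)))
      (torusPartial i φ.1 y) 0 := by
    intro y
    refine DifferentiableAt.hasDerivAt ?_
    obtain ⟨z, rfl⟩ := (isOpenQuotientMap_torusCover n).surjective y
    have hd : Differentiable ℝ (fun x => φ.1 (torusCover n x)) :=
      (contDiff_smoothTorus φ).differentiable (by simp)
    have hl : Differentiable ℝ fun r : ℝ => z + (Pi.single i r : Fin n → ℝ) :=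
      (differentiable_const z).add (ContinuousLinearMap.single ℝ (fun _ : Fin n => ℝ) i).differentiable
    exact (hd.comp hl) 0
  have h1 := (h0 (x + torusCover n (Pi.single i h)))
  rw [← sub_self h] at h1
  have h2 := h1.comp_sub_const h h
  refine h2.congr_of_eventuallyEq (Eventually.of_forall fun r => ?_)
  simp only [add_assoc, ← torusCover_add, ← Pi.single_add, add_sub_cancel]

/-- The partial derivative as a map of smooth functions. -/
def smoothPartial (i : Fin n) (φ : SmoothTorus n) : SmoothTorus n :=
  ⟨torusPartial i φ.1, torusPartial_mem i φ.2⟩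

/-- Translation invariance multiplies the coefficient of a translate by a character; differentiating
under the integral at `h = 0` replaces integration by parts. -/
theorem smoothCoeff_smoothPartial (m : Fin n → ℤ) (i : Fin n) (φ : SmoothTorus n) :
    smoothCoeff m (smoothPartial i φ) = 2 * Real.pi * Complex.I * m i * smoothCoeff m φ := by
  have key : ∀ h : ℝ, ∫ x, mFourier (-m) x * (φ.1 (x + torusCover n (Pi.single i h)) : ℂ) =
      Complex.exp (2 * Real.pi * Complex.I * m i * h) * smoothCoeff m φ := by
    intro h
    rw [smoothCoeff_eq, ← integral_const_mul, ← integral_add_right_eq_self _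
      (-torusCover n (Pi.single i h))]
    refine integral_congr_ae (Eventually.of_forall fun x => ?_)
    have e : -torusCover n (Pi.single i h) = torusCover n (Pi.single i (-h)) := by
      rw [Pi.single_neg]; rfl
    simp only [neg_add_cancel_right]
    rw [mFourier_add_apply, e, mFourier_torusCover_single]
    simp
    ring
  obtain ⟨C, hC⟩ : ∃ C, ∀ x, ‖torusPartial i φ.1 x‖ ≤ C := by
    obtain ⟨C, hC⟩ := isCompact_univ.exists_bound_of_continuousOn
      (continuous_smoothTorus (smoothPartial i φ)).continuousOn
    exact ⟨C, fun x => hC x (mem_univ x)⟩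
  have h1 := (hasDerivAt_integral_of_dominated_loc_of_deriv_le (μ := volume) (x₀ := (0 : ℝ))
    (s := univ) (bound := fun _ => C)
    (F := fun h x => mFourier (-m) x * (φ.1 (x + torusCover n (Pi.single i h)) : ℂ))
    (F' := fun h x => mFourier (-m) x *
      (torusPartial i φ.1 (x + torusCover n (Pi.single i h)) : ℂ)) univ_mem
    (Eventually.of_forall fun h => ?_) ?_ ?_ ?_ (integrable_const _) ?_).2
  · simp only [key] at h1
    have h2 : HasDerivAt (fun h : ℝ => Complex.exp (2 * Real.pi * Complex.I * m i * h) *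
        smoothCoeff m φ) (2 * Real.pi * Complex.I * m i * smoothCoeff m φ) 0 := by
      have h3 : HasDerivAt (fun h : ℝ => 2 * Real.pi * Complex.I * m i * (h : ℂ))
          (2 * Real.pi * Complex.I * m i) 0 := by
        simpa using ((hasDerivAt_id (0 : ℝ)).ofReal_comp).const_mul
          (2 * Real.pi * Complex.I * m i : ℂ)
      simpa using h3.cexp.mul_const (smoothCoeff m φ)
    rw [← h1.unique h2, smoothCoeff_eq]
    refine integral_congr_ae (Eventually.of_forall fun x => ?_)
    have : torusCover n (Pi.single i 0) = 0 := by rw [Pi.single_zero]; rfl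
    simp only [this, add_zero]
    rfl
  · have : Continuous fun x => mFourier (-m) x *
        (φ.1 (x + torusCover n (Pi.single i h)) : ℂ) :=
      (map_continuous _).mul (Complex.continuous_ofReal.comp
        ((continuous_smoothTorus φ).comp (continuous_id.add continuous_const)))
    exact this.aestronglyMeasurable
  · have : torusCover n (Pi.single i 0) = 0 := by rw [Pi.single_zero]; rfl
    simpa only [this, add_zero] using integrable_mul_smoothTorus φ (map_continuous (mFourier (-m)))
  · have : Continuous fun x => mFourier (-m) x *
        (torusPartial i φ.1 (x + torusCover n (Pi.single i 0)) : ℂ) :=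
      (map_continuous _).mul (Complex.continuous_ofReal.comp
        ((continuous_smoothTorus (smoothPartial i φ)).comp (continuous_id.add continuous_const)))
    exact this.aestronglyMeasurable
  · refine Eventually.of_forall fun x h _ => ?_
    simpa [norm_mFourier_apply] using hC (x + torusCover n (Pi.single i h))
  · refine Eventually.of_forall fun x h _ => ?_
    exact (hasDerivAt_torusPartial i φ x h).ofReal_comp.const_mul _

theorem smoothCoeff_torusDiv (m : Fin n → ℤ) (φ : Fin n → SmoothTorus n) :
    smoothCoeff m (torusDiv φ) = ∑ i, 2 * Real.pi * Complex.I * m i * smoothCoeff m (φ i) := by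
  have : torusDiv φ = ∑ i, smoothPartial i (φ i) := rfl
  rw [this, map_sum]
  exact Finset.sum_congr rfl fun i _ => smoothCoeff_smoothPartial m i (φ i)

theorem smoothCoeff_iterate_smoothPartial (m : Fin n → ℤ) (i : Fin n) (φ : SmoothTorus n)
    (k : ℕ) : smoothCoeff m ((smoothPartial i)^[k] φ) =
      (2 * Real.pi * Complex.I * m i) ^ k * smoothCoeff m φ := by
  induction k with
  | zero => simp
  | succ k ih =>
    rw [Function.iterate_succ_apply', smoothCoeff_smoothPartial, ih, pow_succ']
    ring

theorem torusPartial_torusCover (i : Fin n) (φ : SmoothTorus n) (x : Fin n → ℝ) :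
    torusPartial i φ.1 (torusCover n x) =
      fderiv ℝ (fun y => φ.1 (torusCover n y)) x (Pi.single i 1) := by
  have hd : Differentiable ℝ (fun x => φ.1 (torusCover n x)) :=
    (contDiff_smoothTorus φ).differentiable (by simp)
  have h1 := hasDerivAt_torusPartial i φ (torusCover n x) 0
  have h2 : HasDerivAt (fun r : ℝ => x + r • (Pi.single i (1 : ℝ) : Fin n → ℝ))
      (Pi.single i (1 : ℝ) : Fin n → ℝ) 0 := by
    simpa using ((hasDerivAt_id (0 : ℝ)).smul_const
      (Pi.single i (1 : ℝ) : Fin n → ℝ)).const_add x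
  have h3 : HasFDerivAt (fun x => φ.1 (torusCover n x))
      (fderiv ℝ (fun x => φ.1 (torusCover n x)) x)
      (x + (0 : ℝ) • (Pi.single i (1 : ℝ) : Fin n → ℝ)) := by
    simpa using (hd x).hasFDerivAt
  have h4 := h3.comp_hasDerivAt (0 : ℝ) h2
  have e0 : torusCover n x + torusCover n (Pi.single i 0) = torusCover n x := by
    rw [← torusCover_add, Pi.single_zero, add_zero]
  rw [e0] at h1
  refine h1.unique (h4.congr_of_eventuallyEq (Eventually.of_forall fun r => ?_))
  have hs : (Pi.single i r : Fin n → ℝ) = r • (Pi.single i (1 : ℝ) : Fin n → ℝ) := by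
    rw [← Pi.single_smul]; simp
  simp only [Function.comp_apply, ← torusCover_add, hs]

theorem iterate_smoothPartial_torusCover (i : Fin n) (φ : SmoothTorus n) (k : ℕ)
    (x : Fin n → ℝ) : ((smoothPartial i)^[k] φ).1 (torusCover n x) =
      iteratedFDeriv ℝ k (fun y => φ.1 (torusCover n y)) x fun _ => Pi.single i 1 := by
  induction k generalizing x with
  | zero => simp
  | succ k ih =>
    rw [Function.iterate_succ_apply', iteratedFDeriv_succ_apply_left]
    change torusPartial i _ _ = _
    rw [torusPartial_torusCover]
    simp only [ih]
    have hd : DifferentiableAt ℝ (iteratedFDeriv ℝ k fun y => φ.1 (torusCover n y)) x :=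
      (ContDiff.differentiable_iteratedFDeriv (m := k) (n := ∞) (by exact_mod_cast WithTop.coe_lt_top _) φ.2) x
    have := (hd.hasFDerivAt.continuousMultilinear_apply_const fun _ => Pi.single i (1 : ℝ)).fderiv
    rw [this]
    rfl

theorem abs_iterate_smoothPartial_le (i : Fin n) (φ : SmoothTorus n) (k : ℕ) {M : ℝ}
    (h : ∀ x, ‖iteratedFDeriv ℝ k (fun y => φ.1 (torusCover n y)) x‖ ≤ M)
    (x : UnitAddTorus (Fin n)) : |((smoothPartial i)^[k] φ).1 x| ≤ M := by
  obtain ⟨z, rfl⟩ := (isOpenQuotientMap_torusCover n).surjective x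
  rw [iterate_smoothPartial_torusCover, ← Real.norm_eq_abs]
  refine (ContinuousMultilinearMap.le_opNorm _ _).trans ?_
  have : ‖(Pi.single i 1 : Fin n → ℝ)‖ = 1 := by rw [Pi.norm_single, norm_one]
  simpa [this] using h z

/-- Differentiate `k` times in a coordinate where `|m i|` attains the sup norm, and use `2π ≥ 1`.
For `n = 0` there is no coordinate, but then `‖m‖ = 0`. -/
theorem norm_pow_mul_norm_smoothCoeff_le (m : Fin n → ℤ) (φ : SmoothTorus n) (k : ℕ) {M : ℝ}
    (h0 : ∀ x, |φ.1 x| ≤ M)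
    (h : ∀ x, ‖iteratedFDeriv ℝ k (fun y => φ.1 (torusCover n y)) x‖ ≤ M) :
    ‖m‖ ^ k * ‖smoothCoeff m φ‖ ≤ M := by
  have hM : 0 ≤ M := (abs_nonneg _).trans (h0 0)
  rcases eq_or_ne k 0 with rfl | hk
  · simpa using norm_smoothCoeff_le m φ h0
  rcases isEmpty_or_nonempty (Fin n) with hn | hn
  · have : ‖m‖ = 0 := by simp [Subsingleton.elim m 0]
    rw [this, zero_pow hk, zero_mul]
    exact hM
  obtain ⟨i, hi⟩ : ∃ i, ‖m‖ = ‖m i‖ := by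
    obtain ⟨i, hi⟩ := Finite.exists_max fun i => ‖m i‖
    exact ⟨i, le_antisymm ((pi_norm_le_iff_of_nonempty _).2 hi) (norm_le_pi_norm m i)⟩
  have h1 := norm_smoothCoeff_le m _ (abs_iterate_smoothPartial_le i φ k h)
  rw [smoothCoeff_iterate_smoothPartial, norm_mul, norm_pow] at h1
  refine le_trans (mul_le_mul_of_nonneg_right (pow_le_pow_left₀ (norm_nonneg _) ?_ k)
    (norm_nonneg _)) h1
  have e : ‖(2 * Real.pi * Complex.I * m i : ℂ)‖ = 2 * Real.pi * ‖m i‖ := by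
    simp [abs_of_pos Real.pi_pos, Int.norm_eq_abs]
  rw [hi, e]
  have := Real.two_le_pi
  nlinarith [norm_nonneg (m i)]

theorem one_add_norm_pow_mul_norm_smoothCoeff_le (m : Fin n → ℤ) (φ : SmoothTorus n) (k : ℕ)
    {M : ℝ} (h : ∀ j ≤ k, ∀ x, ‖iteratedFDeriv ℝ j (fun y => φ.1 (torusCover n y)) x‖ ≤ M) :
    (1 + ‖m‖) ^ k * ‖smoothCoeff m φ‖ ≤ 2 ^ k * (2 * M) := by
  have h0 : ∀ x, |φ.1 x| ≤ M := fun x => by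
    obtain ⟨z, rfl⟩ := (isOpenQuotientMap_torusCover n).surjective x
    simpa using h 0 (Nat.zero_le _) z
  have h1 := norm_pow_mul_norm_smoothCoeff_le m φ k h0 (h k le_rfl)
  have h2 := norm_smoothCoeff_le m φ h0
  have h3 : (1 + ‖m‖) ^ k ≤ 2 ^ k * (1 + ‖m‖ ^ k) := by
    rcases le_total ‖m‖ 1 with hm | hm
    · calc (1 + ‖m‖) ^ k ≤ 2 ^ k := pow_le_pow_left₀ (by positivity) (by linarith) k
        _ ≤ 2 ^ k * (1 + ‖m‖ ^ k) := le_mul_of_one_le_right (by positivity)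
            (le_add_of_nonneg_right (by positivity))
    · calc (1 + ‖m‖) ^ k ≤ (2 * ‖m‖) ^ k := pow_le_pow_left₀ (by positivity) (by linarith) k
        _ = 2 ^ k * ‖m‖ ^ k := mul_pow _ _ _
        _ ≤ 2 ^ k * (1 + ‖m‖ ^ k) := by gcongr; linarith
  calc (1 + ‖m‖) ^ k * ‖smoothCoeff m φ‖ ≤ 2 ^ k * (1 + ‖m‖ ^ k) * ‖smoothCoeff m φ‖ :=
        mul_le_mul_of_nonneg_right h3 (norm_nonneg _)
    _ = 2 ^ k * (‖smoothCoeff m φ‖ + ‖m‖ ^ k * ‖smoothCoeff m φ‖) := by ring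
    _ ≤ 2 ^ k * (2 * M) := by gcongr; linarith

/-- Derivatives of the lift are periodic, so bounds on the compact unit cube suffice. -/
theorem exists_iteratedFDeriv_bound (φ : SmoothTorus n) (k : ℕ) :
    ∃ M, ∀ j ≤ k, ∀ x, ‖iteratedFDeriv ℝ j (fun y => φ.1 (torusCover n y)) x‖ ≤ M := by
  have hc : ∀ j : ℕ, Continuous fun x => ‖iteratedFDeriv ℝ j (fun y => φ.1 (torusCover n y)) x‖ :=
    fun j => ((contDiff_smoothTorus φ).continuous_iteratedFDeriv
      (by exact_mod_cast le_of_lt (WithTop.coe_lt_top j))).norm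
  have hper : ∀ (j : ℕ) (x : Fin n → ℝ), iteratedFDeriv ℝ j (fun y => φ.1 (torusCover n y)) x =
      iteratedFDeriv ℝ j (fun y => φ.1 (torusCover n y)) fun i => Int.fract (x i) := by
    intro j x
    have h1 := iteratedFDeriv_comp_add_right (𝕜 := ℝ) (f := fun y => φ.1 (torusCover n y)) j
      (fun i => (⌊x i⌋ : ℝ)) fun i => Int.fract (x i)
    have h2 : (fun y => φ.1 (torusCover n (y + fun i => (⌊x i⌋ : ℝ)))) =
        fun y => φ.1 (torusCover n y) := by
      funext y
      have h3 : torusCover n (fun i => (⌊x i⌋ : ℝ)) = 0 := by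
        funext i
        exact AddCircle.coe_eq_zero_iff 1 |>.2 ⟨⌊x i⌋, by simp⟩
      rw [torusCover_add, h3, add_zero]
    have h4 : ((fun i => Int.fract (x i)) + fun i => (⌊x i⌋ : ℝ)) = x := by
      funext i
      simp
    rw [h2, h4] at h1
    exact h1.symm
  have hb : ∀ j : ℕ, ∃ M, ∀ x ∈ Icc (0 : Fin n → ℝ) 1,
      ‖iteratedFDeriv ℝ j (fun y => φ.1 (torusCover n y)) x‖ ≤ M := fun j => by
    obtain ⟨M, hM⟩ := isCompact_Icc.exists_bound_of_continuousOn (hc j).continuousOn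
    exact ⟨M, fun x hx => by simpa using hM x hx⟩
  choose M hM using hb
  refine ⟨∑ j ∈ Finset.range (k + 1), |M j|, fun j hj x => ?_⟩
  rw [hper]
  refine (hM j _ ⟨fun i => Int.fract_nonneg _, fun i => (Int.fract_lt_one _).le⟩).trans
    ((le_abs_self _).trans ?_)
  exact Finset.single_le_sum (f := fun j => |M j|) (fun _ _ => abs_nonneg _)
    (Finset.mem_range.2 (Nat.lt_succ_of_le hj))

/-- Translation by `1 / (2 m i)` in a coordinate with `m i ≠ 0` changes the sign of the character
but not the integral. -/
theorem integral_mFourier_of_ne_zero {m : Fin n → ℤ} (hm : m ≠ 0) :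
    ∫ x : UnitAddTorus (Fin n), mFourier m x = 0 := by
  obtain ⟨i, hi⟩ := Function.ne_iff.1 hm
  have hi' : (m i : ℂ) ≠ 0 := by exact_mod_cast hi
  have h1 := integral_add_right_eq_self (μ := volume) (fun x => mFourier m x)
    (torusCover n (Pi.single i (1 / (2 * (m i : ℝ)))))
  have e : Complex.exp (2 * Real.pi * Complex.I * m i * ((1 / (2 * (m i : ℝ)) : ℝ) : ℂ)) = -1 := by
    rw [← Complex.exp_pi_mul_I]
    congr 1
    push_cast
    field_simp
  simp only [mFourier_add_apply, mFourier_torusCover_single, e, mul_neg, mul_one,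
    integral_neg] at h1
  exact self_eq_neg.1 h1.symm

theorem smoothCoeff_torusCos_sub_torusSin (m k : Fin n → ℤ) :
    smoothCoeff (-m) (torusCos k) - smoothCoeff (-m) (torusSin k) * Complex.I =
      if m = k then 1 else 0 := by
  rw [smoothCoeff_eq, smoothCoeff_eq, ← integral_mul_const, ← integral_sub
    (integrable_mul_smoothTorus (torusCos k) (map_continuous _))
    ((integrable_mul_smoothTorus (torusSin k) (map_continuous _)).mul_const _)]
  have e : ∀ x, mFourier (- -m) x * ((torusCos k).1 x : ℂ) -
      mFourier (- -m) x * ((torusSin k).1 x : ℂ) * Complex.I = mFourier (m + -k) x := by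
    intro x
    rw [mFourier_add, mFourier_neg (n := k), neg_neg, mul_assoc, ← mul_sub]
    congr 1
    change ((mFourier k x).re : ℂ) - ((mFourier k x).im : ℂ) * Complex.I = _
    exact Complex.ext (by simp) (by simp)
  simp only [e]
  split_ifs with h
  · simp [h, mFourier_zero]
  · exact integral_mFourier_of_ne_zero (by rwa [← sub_eq_add_neg, sub_ne_zero])

end TorusFourier

/-! ### Completeness, separability and duality for the homogeneous Sobolev spaces. -/

section HomSobolevTheory

open UnitAddTorus

variable {n : ℕ}

theorem exists_summable_one_add_norm_pow_inv (n : ℕ) :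
    ∃ q : ℕ, Summable fun m : Fin n → ℤ => ((1 + ‖m‖) ^ q)⁻¹ := by
  set L := Submodule.span ℤ (range (Pi.basisFun ℝ (Fin n))) with hL
  set q := Module.finrank ℤ L + 1 with hq
  have hs := ZLattice.summable_norm_pow_inv (L := L) q (Nat.lt_succ_self _)
  have hmem : ∀ m : Fin n → ℤ, (fun i => (m i : ℝ)) ∈ L := by
    intro m
    have : (fun i => (m i : ℝ)) = ∑ i, m i • Pi.basisFun ℝ (Fin n) i := by
      funext j
      simp [Finset.sum_apply, Pi.single_apply]
    rw [this]
    exact Submodule.sum_mem _ fun i _ => Submodule.smul_mem _ _ (Submodule.subset_span ⟨i, rfl⟩)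
  have hinj : Function.Injective fun m : Fin n → ℤ => (⟨fun i => (m i : ℝ), hmem m⟩ : L) := by
    intro m k h
    funext i
    have : (m i : ℝ) = k i := congrFun (congrArg Subtype.val h) i
    exact_mod_cast this
  have h2 := hs.comp_injective hinj
  refine ⟨q, ?_⟩
  -- At `m = 0` the comparison fails, because the inverse norm is `0` by convention; one index is
  -- harmless.
  refine Summable.of_norm_bounded_eventually h2 ?_
  have : {(0 : Fin n → ℤ)}ᶜ ∈ (cofinite : Filter (Fin n → ℤ)) := (finite_singleton _).compl_mem_cofinite
  filter_upwards [this] with m hm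
  have hm : m ≠ 0 := hm
  have e : ‖(⟨fun i => (m i : ℝ), hmem m⟩ : L)‖ = ‖m‖ := rfl
  simp only [Function.comp_apply, e, inv_pow]
  rw [Real.norm_of_nonneg (by positivity)]
  have : 0 < ‖m‖ := norm_pos_iff.2 hm
  gcongr
  linarith

theorem freqWeight_neg (s : ℝ) (m : Fin n → ℤ) : freqWeight s (-m) = freqWeight s m := by
  simp [freqWeight]

theorem exists_freqWeight_inv_le (n : ℕ) (s : ℝ) :
    ∃ (C : ℝ) (p : ℕ), 0 ≤ C ∧ ∀ m : Fin n → ℤ, m ≠ 0 → (freqWeight s m)⁻¹ ≤ C * (1 + ‖m‖) ^ p := by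
  obtain ⟨p, hp⟩ := exists_nat_ge (|s| / 2)
  refine ⟨(n : ℝ) ^ p, 2 * p, by positivity, fun m hm => ?_⟩
  set Q : ℝ := ∑ i, (m i : ℝ) ^ 2 with hQ
  have hQ1 : 1 ≤ Q := by
    obtain ⟨i, hi⟩ := Function.ne_iff.1 hm
    have h1 : (1 : ℝ) ≤ (m i : ℝ) ^ 2 := by
      have : 1 ≤ |m i| := Int.one_le_abs hi
      have h2 : (1 : ℤ) ≤ m i ^ 2 := by rw [← sq_abs]; nlinarith
      exact_mod_cast h2
    exact h1.trans (Finset.single_le_sum (f := fun i => (m i : ℝ) ^ 2)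
      (fun _ _ => sq_nonneg _) (Finset.mem_univ i))
  have hQ2 : Q ≤ n * (1 + ‖m‖) ^ 2 := by
    have : ∀ i ∈ Finset.univ, (m i : ℝ) ^ 2 ≤ (1 + ‖m‖) ^ 2 := fun i _ => by
      have h1 := norm_le_pi_norm m i
      rw [Int.norm_eq_abs] at h1
      rw [← sq_abs]
      exact pow_le_pow_left₀ (abs_nonneg _) (by linarith) 2
    simpa using Finset.sum_le_sum this
  calc (freqWeight s m)⁻¹ = Q ^ (-(s / 2)) := by rw [freqWeight, Real.rpow_neg (by positivity)]
    _ ≤ Q ^ (p : ℝ) := Real.rpow_le_rpow_of_exponent_le hQ1 (by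
        have := neg_abs_le s
        linarith)
    _ = Q ^ p := Real.rpow_natCast _ _
    _ ≤ (n * (1 + ‖m‖) ^ 2) ^ p := pow_le_pow_left₀ (by positivity) hQ2 p
    _ = (n : ℝ) ^ p * (1 + ‖m‖) ^ (2 * p) := by rw [mul_pow, pow_mul]

/-- Control of `p + q` derivatives suffices: `p` orders absorb the polynomial weight and `q` make
the lattice sum converge. -/
theorem exists_sum_norm_smoothCoeff_le (n p : ℕ) : ∃ (N : ℕ) (C : ℝ), 0 ≤ C ∧
    ∀ (φ : SmoothTorus n) (M : ℝ),
      (∀ k ≤ N, ∀ x, ‖iteratedFDeriv ℝ k (fun y => φ.1 (torusCover n y)) x‖ ≤ M) →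
      (Summable fun m : Fin n → ℤ => (1 + ‖m‖) ^ p * ‖smoothCoeff (-m) φ‖) ∧
      ∑' m : Fin n → ℤ, (1 + ‖m‖) ^ p * ‖smoothCoeff (-m) φ‖ ≤ C * M := by
  obtain ⟨q, hq⟩ := exists_summable_one_add_norm_pow_inv n
  refine ⟨p + q, 2 ^ (p + q) * 2 * ∑' m : Fin n → ℤ, ((1 + ‖m‖) ^ q)⁻¹, ?_, fun φ M hM => ?_⟩
  · have : 0 ≤ ∑' m : Fin n → ℤ, ((1 + ‖m‖) ^ q)⁻¹ := tsum_nonneg fun m => by positivity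
    positivity
  have h : ∀ m : Fin n → ℤ, (1 + ‖m‖) ^ p * ‖smoothCoeff (-m) φ‖ ≤
      2 ^ (p + q) * (2 * M) * ((1 + ‖m‖) ^ q)⁻¹ := fun m => by
    have := one_add_norm_pow_mul_norm_smoothCoeff_le (-m) φ (p + q) hM
    rw [norm_neg, pow_add] at this
    rw [← div_eq_mul_inv, le_div_iff₀ (by positivity)]
    linarith
  have hs := hq.mul_left (2 ^ (p + q) * (2 * M))
  have hs' := Summable.of_nonneg_of_le (fun m => by positivity) h hs
  refine ⟨hs', (hs'.tsum_le_tsum h hs).trans (le_of_eq ?_)⟩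
  rw [tsum_mul_left]
  ring

theorem summable_one_add_norm_pow_mul_smoothCoeff (p : ℕ) (φ : SmoothTorus n) :
    Summable fun m : Fin n → ℤ => (1 + ‖m‖) ^ p * ‖smoothCoeff (-m) φ‖ := by
  obtain ⟨N, C, -, h⟩ := exists_sum_norm_smoothCoeff_le n p
  obtain ⟨M, hM⟩ := exists_iteratedFDeriv_bound φ N
  exact (h φ M hM).1

theorem distFourierCoeff_neg (m : Fin n → ℤ) (u : SmoothTorus n →ₗ[ℝ] ℝ) :
    distFourierCoeff (-m) u = (starRingEnd ℂ) (distFourierCoeff m u) := by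
  have h1 : torusCos (-m) = torusCos m := by
    apply Subtype.ext
    funext x
    change (mFourier (-m) x).re = (mFourier m x).re
    rw [mFourier_neg, Complex.conj_re]
  have h2 : torusSin (-m) = -torusSin m := by
    apply Subtype.ext
    funext x
    change (mFourier (-m) x).im = -(mFourier m x).im
    rw [mFourier_neg, Complex.conj_im]
  change (u (torusCos (-m)) : ℂ) - (u (torusSin (-m)) : ℂ) * Complex.I =
    (starRingEnd ℂ) ((u (torusCos m) : ℂ) - (u (torusSin m) : ℂ) * Complex.I)
  rw [h1, h2, map_neg]
  simp

/-- A Hermitian sequence in the weighted `ℓ²` space is the sequence of Fourier coefficients of an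
element of the homogeneous Sobolev space. -/
theorem exists_homSobolev_of_coeff (s : ℝ) (α : (Fin n → ℤ) → ℂ) (h0 : α 0 = 0)
    (hconj : ∀ m, α (-m) = (starRingEnd ℂ) (α m)) (hmem : Memℓp (fun m => freqWeight s m • α m) 2) :
    ∃ u : HomSobolev n s, ∀ m, distFourierCoeff m u.1 = α m := by
  obtain ⟨C, p, hC, hw⟩ := exists_freqWeight_inv_le n s
  set w : lp (fun _ : Fin n → ℤ => ℂ) 2 := ⟨_, hmem⟩ with hwdef
  have hα : ∀ m, ‖α m‖ ≤ ‖w‖ * C * (1 + ‖m‖) ^ p := by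
    intro m
    by_cases hm : m = 0
    · rw [hm, h0, norm_zero]; positivity
    have h1 := lp.norm_apply_le_norm two_ne_zero w m
    have h2 : ‖w m‖ = freqWeight s m * ‖α m‖ := by
      change ‖freqWeight s m • α m‖ = _
      rw [norm_smul, Real.norm_of_nonneg (freqWeight_pos s hm).le]
    rw [h2, mul_comm, ← le_div_iff₀ (freqWeight_pos s hm), div_eq_mul_inv] at h1
    rw [mul_assoc]
    exact h1.trans (mul_le_mul_of_nonneg_left (hw m hm) (norm_nonneg _))
  have hterm : ∀ (φ : SmoothTorus n) (m : Fin n → ℤ), ‖α m * smoothCoeff (-m) φ‖ ≤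
      ‖w‖ * C * ((1 + ‖m‖) ^ p * ‖smoothCoeff (-m) φ‖) := fun φ m => by
    rw [norm_mul, ← mul_assoc]
    exact mul_le_mul_of_nonneg_right (hα m) (norm_nonneg _)
  have hsum : ∀ φ : SmoothTorus n, Summable fun m => α m * smoothCoeff (-m) φ := fun φ =>
    .of_norm_bounded ((summable_one_add_norm_pow_mul_smoothCoeff p φ).mul_left _) (hterm φ)
  set u : SmoothTorus n →ₗ[ℝ] ℝ :=
    { toFun := fun φ => (∑' m, α m * smoothCoeff (-m) φ).re
      map_add' := fun φ ψ => by
        simp only [map_add, mul_add]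
        rw [(hsum φ).tsum_add (hsum ψ), Complex.add_re]
      map_smul' := fun c φ => by
        simp only [map_smul, mul_smul_comm, RingHom.id_apply]
        rw [(hsum φ).tsum_const_smul, Complex.smul_re] } with hu
  have hreal : ∀ φ, ((u φ : ℝ) : ℂ) = ∑' m, α m * smoothCoeff (-m) φ := by
    intro φ
    refine Complex.conj_eq_iff_re.1 ?_
    -- The substitution `m ↦ -m` and Hermitian symmetry show that the series equals its conjugate,
    -- so taking the real part loses nothing.
    rw [Complex.conj_tsum, ← (Equiv.neg (Fin n → ℤ)).tsum_eq]
    refine tsum_congr fun m => ?_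
    simp only [Equiv.neg_apply, map_mul, conj_smoothCoeff, neg_neg, hconj, Complex.conj_conj]
  have hHas : ∀ φ, HasSum (fun m => α m * smoothCoeff (-m) φ) (u φ : ℂ) := fun φ => by
    rw [hreal]; exact (hsum φ).hasSum
  have hcoef : ∀ k, distFourierCoeff k u = α k := by
    intro k
    have h1 := (hHas (torusCos k)).sub ((hHas (torusSin k)).mul_right Complex.I)
    simp only [mul_assoc, ← mul_sub, smoothCoeff_torusCos_sub_torusSin, mul_ite, mul_one,
      mul_zero] at h1
    have h2 : (fun m => if m = k then α m else 0) = fun m => if m = k then α k else 0 := by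
      funext m
      split_ifs with h <;> simp [h]
    rw [h2] at h1
    exact h1.unique (hasSum_ite_eq k (α k))
  refine ⟨⟨u, ?_, ?_, ?_, ?_⟩, hcoef⟩
  · obtain ⟨N, D, hD, h⟩ := exists_sum_norm_smoothCoeff_le n p
    refine ⟨N, ‖w‖ * C * D, fun φ M hM => ?_⟩
    obtain ⟨h1, h2⟩ := h φ M hM
    have h3 : |u φ| = ‖∑' m, α m * smoothCoeff (-m) φ‖ := by rw [← hreal]; simp
    rw [h3]
    refine (tsum_of_norm_bounded (h1.mul_left (‖w‖ * C)).hasSum (hterm φ)).trans ?_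
    rw [tsum_mul_left, mul_assoc _ D]
    exact mul_le_mul_of_nonneg_left h2 (by positivity)
  · rw [hcoef, h0]
  · simpa only [hcoef] using hmem
  · intro φ
    simp only [hcoef]
    exact hHas φ

theorem HomSobolev.isometry_toL2 (n : ℕ) (s : ℝ) : Isometry (HomSobolev.toL2 n s) :=
  AddMonoidHomClass.isometry_of_norm _ fun _ => rfl

theorem HomSobolev.toL2_apply {s : ℝ} (u : HomSobolev n s) (m : Fin n → ℤ) :
    HomSobolev.toL2 n s u m = freqWeight s m • distFourierCoeff m u.1 := rfl

/-- This describes the image by closed conditions on coordinates of `ℓ²`, whence completeness. -/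
theorem HomSobolev.range_toL2 (n : ℕ) (s : ℝ) : range (HomSobolev.toL2 n s) =
    {w | w 0 = 0 ∧ ∀ m, w (-m) = (starRingEnd ℂ) (w m)} := by
  ext w
  constructor
  · rintro ⟨u, rfl⟩
    refine ⟨?_, fun m => ?_⟩
    · rw [HomSobolev.toL2_apply, u.2.2.1, smul_zero]
    · rw [HomSobolev.toL2_apply, HomSobolev.toL2_apply, distFourierCoeff_neg, freqWeight_neg]
      simp
  · rintro ⟨h0, hconj⟩
    have e : ∀ m, freqWeight s m • ((freqWeight s m)⁻¹ • w m) = w m := by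
      intro m
      by_cases hm : m = 0
      -- The weight at `m = 0` vanishes unless `s = 0`, so the identity rests on `w 0 = 0`.
      · simp [hm, h0]
      · rw [smul_smul, mul_inv_cancel₀ (freqWeight_pos s hm).ne', one_smul]
    obtain ⟨u, hu⟩ := exists_homSobolev_of_coeff s (fun m => (freqWeight s m)⁻¹ • w m)
      (by rw [h0, smul_zero]) (fun m => by rw [hconj, freqWeight_neg]; simp)
      (by simp only [e]; exact lp.memℓp w)
    refine ⟨u, ?_⟩
    ext m
    rw [HomSobolev.toL2_apply, hu, e]

instance HomSobolev.completeSpace (n : ℕ) (s : ℝ) : CompleteSpace (HomSobolev n s) := by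
  refine (HomSobolev.isometry_toL2 n s).isUniformInducing.completeSpace ?_
  rw [HomSobolev.range_toL2]
  refine IsClosed.isComplete ?_
  have hc : ∀ m : Fin n → ℤ, Continuous fun w : lp (fun _ : Fin n → ℤ => ℂ) 2 => w m := fun m =>
    (lp.evalCLM ℂ (fun _ : Fin n → ℤ => ℂ) 2 m).continuous
  refine (isClosed_eq (hc 0) continuous_const).inter ?_
  have : IsClosed (⋂ m, {w : lp (fun _ : Fin n → ℤ => ℂ) 2 | w (-m) = (starRingEnd ℂ) (w m)}) :=
    isClosed_iInter fun m => isClosed_eq (hc _) (Complex.continuous_conj.comp (hc m))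
  rwa [← ofPred_forall] at this

theorem HomSobolev.norm_coeff_le {s : ℝ} (u : HomSobolev n s) {m : Fin n → ℤ} (hm : m ≠ 0) :
    ‖distFourierCoeff m u.1‖ ≤ ‖u‖ * (freqWeight s m)⁻¹ := by
  have h1 := lp.norm_apply_le_norm two_ne_zero (HomSobolev.toL2 n s u) m
  rw [HomSobolev.toL2_apply, norm_smul, Real.norm_of_nonneg (freqWeight_pos s hm).le, mul_comm] at h1
  rwa [← div_eq_mul_inv, le_div_iff₀ (freqWeight_pos s hm)]

/-- Evaluation of the elements of the homogeneous Sobolev space at a smooth function is bounded. -/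
theorem HomSobolev.exists_bound_apply (s : ℝ) (ψ : SmoothTorus n) :
    ∃ C, ∀ u : HomSobolev n s, ‖u.1 ψ‖ ≤ C * ‖u‖ := by
  obtain ⟨C, p, hC, hw⟩ := exists_freqWeight_inv_le n s
  have hs := summable_one_add_norm_pow_mul_smoothCoeff p ψ
  refine ⟨C * ∑' m : Fin n → ℤ, (1 + ‖m‖) ^ p * ‖smoothCoeff (-m) ψ‖, fun u => ?_⟩
  have h1 : HasSum (fun m => distFourierCoeff m u.1 * smoothCoeff (-m) ψ) (u.1 ψ : ℂ) :=
    u.2.2.2.2 ψ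
  have h2 := tsum_of_norm_bounded (f := fun m => distFourierCoeff m u.1 * smoothCoeff (-m) ψ)
    (hs.mul_left (‖u‖ * C)).hasSum fun m => by
      rw [norm_mul, ← mul_assoc]
      refine mul_le_mul_of_nonneg_right ?_ (norm_nonneg _)
      by_cases hm : m = 0
      · rw [hm, u.2.2.1, norm_zero]; positivity
      rw [mul_assoc]
      exact (HomSobolev.norm_coeff_le u hm).trans (mul_le_mul_of_nonneg_left (hw m hm) (norm_nonneg _))
  rw [h1.tsum_eq, Complex.norm_real, tsum_mul_left] at h2
  linarith

/-- The Riesz representative of evaluation at a smooth function. -/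
theorem HomSobolev.exists_representative (s : ℝ) (ψ : SmoothTorus n) :
    ∃ f : HomSobolev n s, ∀ u : HomSobolev n s, inner ℝ f u = u.1 ψ := by
  obtain ⟨C, hC⟩ := HomSobolev.exists_bound_apply s ψ
  set L : HomSobolev n s →L[ℝ] ℝ := LinearMap.mkContinuous
    { toFun := fun u => u.1 ψ, map_add' := fun _ _ => rfl, map_smul' := fun _ _ => rfl } C hC
  refine ⟨(InnerProductSpace.toDual ℝ _).symm L, fun u => ?_⟩
  rw [InnerProductSpace.toDual_symm_apply]
  rfl

theorem HomSobolev.eq_zero_of_coeff {s : ℝ} {u : HomSobolev n s}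
    (h : ∀ m, m ≠ 0 → distFourierCoeff m u.1 = 0) : u = 0 := by
  refine HomSobolev.toL2_injective n s ?_
  rw [map_zero]
  ext m
  rw [HomSobolev.toL2_apply]
  by_cases hm : m = 0
  · rw [hm, u.2.2.1, smul_zero]; rfl
  · rw [h m hm, smul_zero]; rfl

/-- The representatives of evaluation at the countably many `torusCos m` and `torusSin m` have
trivial orthogonal complement, since these evaluations determine all Fourier coefficients. -/
instance HomSobolev.separableSpace (n : ℕ) (s : ℝ) :
    TopologicalSpace.SeparableSpace (HomSobolev n s) := by
  choose r hr using HomSobolev.exists_representative (n := n) s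
  set S : Set (HomSobolev n s) :=
    range (fun m => r (torusCos m)) ∪ range (fun m => r (torusSin m)) with hS
  have hSc : S.Countable := (countable_range _).union (countable_range _)
  have horth : (Submodule.span ℝ S)ᗮ = ⊥ := by
    rw [Submodule.eq_bot_iff]
    intro u hu
    rw [Submodule.mem_orthogonal] at hu
    refine HomSobolev.eq_zero_of_coeff fun m _ => ?_
    have h1 := hu _ (Submodule.subset_span (Or.inl ⟨m, rfl⟩))
    have h2 := hu _ (Submodule.subset_span (Or.inr ⟨m, rfl⟩))
    rw [hr] at h1 h2
    change (u.1 (torusCos m) : ℂ) - (u.1 (torusSin m) : ℂ) * Complex.I = 0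
    rw [h1, h2]
    simp
  have hd := Submodule.topologicalClosure_eq_top_iff.2 horth
  rw [← Submodule.dense_iff_topologicalClosure_eq_top] at hd
  have hsep := (hSc.isSeparable.span (R := ℝ)).closure
  rw [hd.closure_eq] at hsep
  exact TopologicalSpace.isSeparable_univ_iff.1 hsep

end HomSobolevTheory

/-! ### The weighted total variation as a support function, and density of its domain. -/

section WeightedTotalVariation

open UnitAddTorus

variable {n : ℕ}

/-- Smooth vector fields on the torus that are pointwise bounded by `a`. -/
def admissibleFields (a : UnitAddTorus (Fin n) → ℝ≥0∞) : Set (Fin n → SmoothTorus n) :=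
  {φ | ∀ x, ENNReal.ofReal (Real.sqrt (∑ i, (φ i).1 x ^ 2)) ≤ a x}

/-- The elements of `Ḣ^s_av` that represent `u ↦ -⟨u, div φ⟩` for admissible `φ`. -/
def dualFields (s : ℝ) (a : UnitAddTorus (Fin n) → ℝ≥0∞) : Set (HomSobolev n s) :=
  {f | ∃ φ ∈ admissibleFields a, ∀ u : HomSobolev n s, inner ℝ f u = -(u.1 (torusDiv φ))}

theorem torusDiv_zero : torusDiv (0 : Fin n → SmoothTorus n) = 0 := by
  refine Finset.sum_eq_zero fun i _ => Subtype.ext ?_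
  funext x
  change deriv (fun _ : ℝ => (0 : ℝ)) 0 = 0
  simp

theorem zero_mem_dualFields (s : ℝ) (a : UnitAddTorus (Fin n) → ℝ≥0∞) :
    (0 : HomSobolev n s) ∈ dualFields s a := by
  refine ⟨0, fun x => by simp, fun u => ?_⟩
  rw [torusDiv_zero, map_zero, neg_zero, inner_zero_left]

theorem weightedTV_eq_iSup_dualFields (s : ℝ) (a : UnitAddTorus (Fin n) → ℝ≥0∞)
    (u : HomSobolev n s) :
    weightedTV a u.1 = ⨆ f ∈ dualFields s a, ((inner ℝ f u : ℝ) : EReal) := by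
  refine le_antisymm (iSup₂_le fun φ hφ => ?_) (iSup₂_le ?_)
  · obtain ⟨f, hf⟩ := HomSobolev.exists_representative s (-torusDiv φ)
    have hf' : ∀ u : HomSobolev n s, inner ℝ f u = -(u.1 (torusDiv φ)) := fun u => by
      rw [hf, map_neg]
    rw [← hf' u]
    exact le_iSup₂_of_le f ⟨φ, hφ, hf'⟩ le_rfl
  · rintro f ⟨φ, hφ, hf⟩
    rw [hf]
    exact le_iSup₂_of_le φ hφ le_rfl

theorem norm_smoothCoeff_le_lintegral {a : UnitAddTorus (Fin n) → ℝ≥0∞} (ha : ∫⁻ x, a x < ⊤)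
    {φ : Fin n → SmoothTorus n} (hφ : φ ∈ admissibleFields a) (m : Fin n → ℤ) (i : Fin n) :
    ‖smoothCoeff m (φ i)‖ ≤ (∫⁻ x, a x).toReal := by
  refine (norm_smoothCoeff_le_integral m (φ i)).trans ?_
  rw [integral_eq_lintegral_of_nonneg_ae (Eventually.of_forall fun x => abs_nonneg _)
    (continuous_smoothTorus (φ i)).abs.aestronglyMeasurable]
  refine ENNReal.toReal_mono ha.ne (lintegral_mono fun x => ?_)
  refine (ENNReal.ofReal_le_ofReal ?_).trans (hφ x)
  exact Real.abs_le_sqrt (Finset.single_le_sum (f := fun i => (φ i).1 x ^ 2)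
    (fun _ _ => sq_nonneg _) (Finset.mem_univ i))

/-- The elements of `Ḣ^s_av` for which the pairings with the divergences of admissible fields are
bounded. -/
def boundedVariation (s : ℝ) (a : UnitAddTorus (Fin n) → ℝ≥0∞) :
    Submodule ℝ (HomSobolev n s) where
  carrier := {u | ∃ C : ℝ, ∀ φ ∈ admissibleFields a, |u.1 (torusDiv φ)| ≤ C}
  zero_mem' := ⟨0, fun φ _ => by simp⟩
  add_mem' := by
    rintro u v ⟨C, hC⟩ ⟨D, hD⟩
    exact ⟨C + D, fun φ hφ => (abs_add_le _ _).trans (add_le_add (hC φ hφ) (hD φ hφ))⟩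
  smul_mem' := by
    rintro c u ⟨C, hC⟩
    refine ⟨|c| * C, fun φ hφ => ?_⟩
    change |c * u.1 (torusDiv φ)| ≤ _
    rw [abs_mul]
    exact mul_le_mul_of_nonneg_left (hC φ hφ) (abs_nonneg c)

theorem boundedVariation_subset_effectiveDomain (s : ℝ) (a : UnitAddTorus (Fin n) → ℝ≥0∞) :
    (boundedVariation s a : Set (HomSobolev n s)) ⊆
      effectiveDomain fun v : HomSobolev n s => weightedTV a v.1 := by
  rintro u ⟨C, hC⟩
  refine lt_of_le_of_lt (iSup₂_le fun φ hφ => ?_) (EReal.coe_lt_top C)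
  exact EReal.coe_le_coe_iff.2 ((neg_le_abs _).trans (hC φ hφ))

/-- For a trigonometric polynomial the pairing with `div φ` is a finite sum, and each coefficient of
`φ i` is bounded by `∫ a` uniformly over admissible `φ`. -/
theorem mem_boundedVariation_of_finite {s : ℝ} {a : UnitAddTorus (Fin n) → ℝ≥0∞}
    (ha : ∫⁻ x, a x < ⊤) {u : HomSobolev n s} {F : Finset (Fin n → ℤ)}
    (hF : ∀ m ∉ F, distFourierCoeff m u.1 = 0) : u ∈ boundedVariation s a := by
  refine ⟨∑ m ∈ F, ‖distFourierCoeff m u.1‖ *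
    ∑ i, ‖(2 * Real.pi * Complex.I * (-m) i : ℂ)‖ * (∫⁻ x, a x).toReal, fun φ hφ => ?_⟩
  have h1 : HasSum (fun m => distFourierCoeff m u.1 * smoothCoeff (-m) (torusDiv φ))
      (u.1 (torusDiv φ) : ℂ) := u.2.2.2.2 _
  have h2 := h1.unique (hasSum_sum_of_ne_finset_zero fun m hm => by rw [hF m hm, zero_mul])
  rw [← Real.norm_eq_abs, ← Complex.norm_real, h2]
  refine (norm_sum_le _ _).trans (Finset.sum_le_sum fun m _ => ?_)
  rw [norm_mul, smoothCoeff_torusDiv]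
  refine mul_le_mul_of_nonneg_left ((norm_sum_le _ _).trans (Finset.sum_le_sum fun i _ => ?_))
    (norm_nonneg _)
  rw [norm_mul]
  exact mul_le_mul_of_nonneg_left (norm_smoothCoeff_le_lintegral ha hφ _ _) (norm_nonneg _)

/-- The truncation of `v` to finitely many frequencies lies in the subspace, and orthogonality to it
forces those coefficients of `v` to vanish. -/
theorem orthogonal_boundedVariation {s : ℝ} {a : UnitAddTorus (Fin n) → ℝ≥0∞}
    (ha : ∫⁻ x, a x < ⊤) : (boundedVariation s a)ᗮ = ⊥ := by
  rw [Submodule.eq_bot_iff]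
  intro v hv
  rw [Submodule.mem_orthogonal'] at hv
  refine HomSobolev.eq_zero_of_coeff fun k hk => ?_
  -- Both `k` and `-k` are kept so that the truncation is a real distribution.
  set F : Finset (Fin n → ℤ) := {k, -k} with hF
  have hneg : ∀ m, -m ∈ F ↔ m ∈ F := fun m => by
    simp only [hF, Finset.mem_insert, Finset.mem_singleton, neg_eq_iff_eq_neg, neg_neg]
    exact or_comm
  obtain ⟨u, hu⟩ := exists_homSobolev_of_coeff s
    (fun m => if m ∈ F then distFourierCoeff m v.1 else 0) (by simp [v.2.2.1])
    (fun m => by simp only [hneg, distFourierCoeff_neg]; split_ifs <;> simp)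
    (memℓp_gen (summable_of_ne_finset_zero (s := F) fun m hm => by simp [hm]))
  have h1 := hv u (mem_boundedVariation_of_finite ha (F := F) fun m hm => by rw [hu, if_neg hm])
  rw [HomSobolev.inner_eq, tsum_eq_sum (s := F) fun m hm => by simp [hu, hm]] at h1
  have h2 : ∀ m ∈ F, freqWeight s m ^ 2 * (distFourierCoeff m v.1 *
      (starRingEnd ℂ) (distFourierCoeff m u.1)).re =
      freqWeight s m ^ 2 * ‖distFourierCoeff m v.1‖ ^ 2 := fun m hm => by
    rw [hu, if_pos hm, Complex.mul_conj']
    norm_cast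
  rw [Finset.sum_congr rfl h2, Finset.sum_eq_zero_iff_of_nonneg fun m _ => by positivity] at h1
  have h3 := h1 k (by simp [hF])
  simpa [(freqWeight_pos s hk).ne'] using h3

theorem closure_effectiveDomain_weightedTV {s : ℝ} {a : UnitAddTorus (Fin n) → ℝ≥0∞}
    (ha : ∫⁻ x, a x < ⊤) :
    closure (effectiveDomain fun v : HomSobolev n s => weightedTV a v.1) = univ := by
  have hd := Submodule.topologicalClosure_eq_top_iff.2 (orthogonal_boundedVariation (s := s) ha)
  rw [← Submodule.dense_iff_topologicalClosure_eq_top] at hd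
  exact (hd.mono (boundedVariation_subset_effectiveDomain s a)).closure_eq

end WeightedTotalVariation

end

theorem mainTheorem9 (n : ℕ) (s : ℝ) (a : UnitAddTorus (Fin n) → ℝ≥0∞)
    (ha : LowerSemicontinuous a) :
    (∀ u₀ : HomSobolev n (-s),
      u₀ ∈ closure (effectiveDomain fun v : HomSobolev n (-s) => weightedTV a v.1) →
        ∃! u : C(ℝ≥0, HomSobolev n (-s)),
          IsGradientFlow (fun v : HomSobolev n (-s) => weightedTV a v.1) u₀ u) ∧
    ((∫⁻ x, a x) < ⊤ → ∀ u₀ : HomSobolev n (-s),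
      ∃! u : C(ℝ≥0, HomSobolev n (-s)),
        IsGradientFlow (fun v : HomSobolev n (-s) => weightedTV a v.1) u₀ u) := by
  have h1 : ∀ u₀ : HomSobolev n (-s),
      u₀ ∈ closure (effectiveDomain fun v : HomSobolev n (-s) => weightedTV a v.1) →
        ∃! u : C(ℝ≥0, HomSobolev n (-s)),
          IsGradientFlow (fun v : HomSobolev n (-s) => weightedTV a v.1) u₀ u := fun u₀ hu₀ =>
    existsUnique_isGradientFlow (zero_mem_dualFields (-s) a)
      (weightedTV_eq_iSup_dualFields (-s) a) hu₀
  exact ⟨h1, fun hint u₀ => h1 u₀ (by rw [closure_effectiveDomain_weightedTV hint]; trivial)⟩
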